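/- **Conventions.** An algebraic circuit is a finite directed acyclic graph with one output node whose inner nodes are binary gates; its size is its number of nodes. A *constant-free circuit over $\mathbb{Q}$* has leaves labelled by variables or by $0,1,-1$ and gates $+,\times,\div$, where the divisor of every division gate is a sub-circuit that contains no variables and computes a nonzero constant. For $M\in\mathbb{Z}$, $\tau(M)$ is the minimal size of a division-free and variable-free such circuit computing $M$. Let $\overline{\mathcal F}=\{F_j(\overline x)=0\}_{j=1}^m$ be polynomial equations in $x_1,\dots,x_n$, each $F_j$ given as a constant-free circuit over $\mathbb{Q}$. *IPS.* A constant-free $\mathrm{IPS}_{\mathbb Q}$ refutation of $\overline{\mathcal F}$ is a constant-free circuit $R(\overline x,\overline y,\overline z)$ over $\mathbb{Q}$ in the variables $x_1,\dots,x_n$, $y_1,\dots,y_m$, $z_1,\dots,z_n$ such that, as formal polynomial identities, $R(\overline x,\overline 0,\overline 0)=0$ and $R(\overline x,F_1,\dots,F_m,x_1^2-x_1,\dots,x_n^2-x_n)=1$. Its size is the size of $R$. *CPS.* A squaring gate is a product gate whose two incoming edges come from the same node. A circuit $C(\overline x,\overline y)$ is $\overline y$-conic if every path to the output node from a leaf labelled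 by $-1$ or by a variable of $\overline x$ contains a squaring gate. Let $\overline{\mathcal H}$ consist of $F_j$ and $-F_j$ ($j\le m$) and of $x_i^2-x_i$, $-(x_i^2-x_i)$, $x_i$, $1-x_i$ ($i\le n$), written as circuits, with $-A:=(-1)\cdot A$ and $A-B:=A+(-1)\cdot B$. A constant-free $\mathrm{CPS}_{\mathbb Q}$ refutation of $\overline{\mathcal F}$ is a $\overline y$-conic constant-free circuit $C(\overline x,\overline y)$ over $\mathbb{Q}$, with one placeholder variable in $\overline y$ for each member of $\overline{\mathcal H}$, such that $C(\overline x,\overline{\mathcal H})=-1$ as a formal polynomial identity. *Syntactic length.* In a division-free circuit a leaf has length $2$, a sum of gates of lengths $a,b$ has length $\max(a,b)+1$, and their product has length $2\max(a,b)+3$. A circuit over $\mathbb{Q}$ is turned into a division-free one by clearing denominators gate by gate: a gate $g$ is replaced by a division-free circuit $g'$ computing $M_g\cdot g$, together with a division-free, variable-free circuit for the nonzero integer $M_g$. Leaves are left unchanged with $M_g=1$, and $$(g+h)'=M_h g'+M_g h',\quad M_{g+h}=M_gM_h;\qquad (g\cdot h)'=g'\cdot h',\quad M_{g\cdot h}=M_gM_h;\qquad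 (g\div h)'=M_h g',\quad M_{g\div h}=M_g h',$$ where trivial multipliers $1$ are omitted. The syntactic length of the given circuit is the length of the resulting division-free one. *Binary value principle.* $\mathrm{BVP}_{t,M}$ is the single equation $x_1+2x_2+\dots+2^{t-1}x_t=-M$. **Theorem.** There are an absolute constant $c$ and a polynomial $P$ such that the following holds for all $n,m$, all systems $\overline{\mathcal F}$ as above and all $s,t,r\in\mathbb{N}$. Suppose that $\overline{\mathcal F}$ has a constant-free $\mathrm{CPS}_{\mathbb Q}$ refutation $C$ such that $C(\overline x,\overline y)$ and $C(\overline x,\overline{\mathcal H})$ (the circuit after the axioms have been substituted for the placeholders) have size at most $s$ and $C(\overline x,\overline{\mathcal H})$ has syntactic length $t$. Suppose further that for every positive integer $M$ with $\tau(M)\le c\,s$ the principle $\mathrm{BVP}_{t,M}$ has a constant-free $\mathrm{IPS}_{\mathbb Q}$ refutation of size at most $r$. Then $\overline{\mathcal F}$ has a constant-free $\mathrm{IPS}_{\mathbb Q}$ refutation of size at most $P(s,t,r)$. -/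

import Mathlib

/-- A constant-free algebraic circuit over `ℚ` in the variables `V`: the leaves are variables and the
constants `0, 1, -1`, the inner nodes are binary gates `+`, `×`, `÷`.

A circuit is a directed acyclic graph in which two gates computed in the same way from the same nodes
are identified (identifying them never increases the size).  It is given here by its unfolding from
the output node: the nodes of the graph are the *distinct* sub-terms, see `AlgCircuit.nodes`. -/
inductive AlgCircuit (V : Type) : Type
  | var (v : V) : AlgCircuit V
  | zero : AlgCircuit V
  | one : AlgCircuit V
  | negOne : AlgCircuit V
  | add (a b : AlgCircuit V) : AlgCircuit V
  | mul (a b : AlgCircuit V) : AlgCircuit V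
  | div (a b : AlgCircuit V) : AlgCircuit V

namespace AlgCircuit

variable {V W : Type}

open Classical in
/-- The nodes of the circuit, as a directed acyclic graph: every sub-circuit is one node, which may be
used (have edges to other gates) arbitrarily often. -/
noncomputable def nodes : AlgCircuit V → Finset (AlgCircuit V)
  | var v => {var v}
  | zero => {zero}
  | one => {one}
  | negOne => {negOne}
  | add a b => insert (add a b) (nodes a ∪ nodes b)
  | mul a b => insert (mul a b) (nodes a ∪ nodes b)
  | div a b => insert (div a b) (nodes a ∪ nodes b)

/-- The size of a circuit: its number of nodes. -/
noncomputable def size (C : AlgCircuit V) : ℕ := C.nodes.card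

/-- The polynomial computed by the circuit.  In a legitimate circuit (`AlgCircuit.Valid`) the divisor
of a division gate computes a nonzero constant, by which the dividend is divided. -/
noncomputable def poly : AlgCircuit V → MvPolynomial V ℚ
  | var v => MvPolynomial.X v
  | zero => 0
  | one => 1
  | negOne => -1
  | add a b => poly a + poly b
  | mul a b => poly a * poly b
  | div a b => MvPolynomial.C (MvPolynomial.constantCoeff (poly b))⁻¹ * poly a

/-- The circuit contains no variables. -/
def VarFree : AlgCircuit V → Prop
  | var _ => False
  | zero => True
  | one => True
  | negOne => True
  | add a b => VarFree a ∧ VarFree b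
  | mul a b => VarFree a ∧ VarFree b
  | div a b => VarFree a ∧ VarFree b

/-- The circuit contains no division gates. -/
def DivFree : AlgCircuit V → Prop
  | var _ => True
  | zero => True
  | one => True
  | negOne => True
  | add a b => DivFree a ∧ DivFree b
  | mul a b => DivFree a ∧ DivFree b
  | div _ _ => False

/-- Legitimacy of a constant-free circuit over `ℚ`: the divisor of every division gate contains no
variables and computes a nonzero constant. -/
def Valid : AlgCircuit V → Prop
  | var _ => True
  | zero => True
  | one => True
  | negOne => True
  | add a b => Valid a ∧ Valid b
  | mul a b => Valid a ∧ Valid b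
  | div a b => Valid a ∧ Valid b ∧ VarFree b ∧ poly b ≠ 0

/-- Substitution of circuits for the variables. -/
def subst (h : V → AlgCircuit W) : AlgCircuit V → AlgCircuit W
  | var v => h v
  | zero => zero
  | one => one
  | negOne => negOne
  | add a b => add (subst h a) (subst h b)
  | mul a b => mul (subst h a) (subst h b)
  | div a b => div (subst h a) (subst h b)

/-- `NonSquarePath u C`: there is a path from the node `u` to the output node of `C` on which no gate
above `u` is a squaring gate.  A squaring gate is a product gate both of whose incoming edges come
from the same node. -/
inductive NonSquarePath (u : AlgCircuit V) : AlgCircuit V → Prop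
  | refl : NonSquarePath u u
  | add_left {a : AlgCircuit V} (b : AlgCircuit V) : NonSquarePath u a → NonSquarePath u (add a b)
  | add_right (a : AlgCircuit V) {b : AlgCircuit V} : NonSquarePath u b → NonSquarePath u (add a b)
  | mul_left {a b : AlgCircuit V} : a ≠ b → NonSquarePath u a → NonSquarePath u (mul a b)
  | mul_right {a b : AlgCircuit V} : a ≠ b → NonSquarePath u b → NonSquarePath u (mul a b)
  | div_left {a : AlgCircuit V} (b : AlgCircuit V) : NonSquarePath u a → NonSquarePath u (div a b)
  | div_right (a : AlgCircuit V) {b : AlgCircuit V} : NonSquarePath u b → NonSquarePath u (div a b)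

/-- Let `Y` be a set of variables, regarded as nonnegative.  The circuit is `Y`-conic if every path to
the output from a leaf that is a negative constant or a variable outside `Y` contains a squaring
gate. -/
def Conic (Y : Set V) (C : AlgCircuit V) : Prop :=
  ¬ NonSquarePath negOne C ∧ ∀ v, v ∉ Y → ¬ NonSquarePath (var v) C

/-! ### Clearing denominators and the syntactic length -/

/-- Product with a multiplier, where `none` is the trivial multiplier `1`, which is not written. -/
def scale : Option (AlgCircuit V) → AlgCircuit V → AlgCircuit V
  | none, a => a
  | some k, a => mul k a

/-- Product of two multipliers, where `none` is the trivial multiplier `1`. -/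
def mulMultiplier (k : Option (AlgCircuit V)) : Option (AlgCircuit V) → Option (AlgCircuit V)
  | none => k
  | some l => some (scale k l)

/-- Clearing denominators, gate by gate.  From a circuit `C` over `ℚ` we get a division-free circuit
that computes `M` times the polynomial of `C`, together with a division-free circuit that computes the
nonzero integer `M` (`none` if `M` is the trivial multiplier `1`; so a division-free circuit is left as
it is).  With `a ↦ (a', M)` and `b ↦ (b', N)`:
* `a + b ↦ (N a' + M b', M N)`,
* `a × b ↦ (a' b', M N)`,
* `a ÷ b ↦ (N a', M b')`. -/
def clearDenoms : AlgCircuit V → AlgCircuit V × Option (AlgCircuit V)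
  | var v => (var v, none)
  | zero => (zero, none)
  | one => (one, none)
  | negOne => (negOne, none)
  | add a b =>
      (add (scale (clearDenoms b).2 (clearDenoms a).1) (scale (clearDenoms a).2 (clearDenoms b).1),
        mulMultiplier (clearDenoms a).2 (clearDenoms b).2)
  | mul a b =>
      (mul (clearDenoms a).1 (clearDenoms b).1,
        mulMultiplier (clearDenoms a).2 (clearDenoms b).2)
  | div a b =>
      (scale (clearDenoms b).2 (clearDenoms a).1, some (scale (clearDenoms a).2 (clearDenoms b).1))

theorem divFree_scale {k : Option (AlgCircuit V)} {a : AlgCircuit V} (hk : ∀ l ∈ k, DivFree l)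
    (ha : DivFree a) : DivFree (scale k a) := by
  cases k with
  | none => exact ha
  | some l => exact ⟨hk l rfl, ha⟩

/-- Clearing denominators removes all division gates. -/
theorem divFree_clearDenoms (C : AlgCircuit V) :
    DivFree (clearDenoms C).1 ∧ ∀ l ∈ (clearDenoms C).2, DivFree l := by
  have hmul : ∀ k l : Option (AlgCircuit V), (∀ u ∈ k, DivFree u) → (∀ u ∈ l, DivFree u) →
      ∀ u ∈ mulMultiplier k l, DivFree u := by
    intro k l hk hl u hu
    cases l with
    | none => exact hk u hu
    | some l =>
      cases hu
      exact divFree_scale hk (hl l rfl)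
  induction C with
  | var v => exact ⟨trivial, fun l hl => by cases hl⟩
  | zero => exact ⟨trivial, fun l hl => by cases hl⟩
  | one => exact ⟨trivial, fun l hl => by cases hl⟩
  | negOne => exact ⟨trivial, fun l hl => by cases hl⟩
  | add a b iha ihb =>
    exact ⟨⟨divFree_scale ihb.2 iha.1, divFree_scale iha.2 ihb.1⟩, hmul _ _ iha.2 ihb.2⟩
  | mul a b iha ihb => exact ⟨⟨iha.1, ihb.1⟩, hmul _ _ iha.2 ihb.2⟩
  | div a b iha ihb =>
    refine ⟨divFree_scale ihb.2 iha.1, fun l hl => ?_⟩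
    cases hl
    exact divFree_scale iha.2 ihb.1

/-- The syntactic length of a division-free circuit: the number of bits reserved, in two's complement
notation, for the integer that the output gate computes when the variables range over `{0, 1}`.
A leaf has two bits; the sum of two `t`-bit integers has `t + 1` bits, and `2 t + 3` bits are used for
their product; the shorter integer is first padded to the length of the longer one.
(The value at a division gate is irrelevant, see `divFree_clearDenoms`.) -/
def intLength : AlgCircuit V → ℕ
  | var _ => 2
  | zero => 2
  | one => 2
  | negOne => 2
  | add a b => max (intLength a) (intLength b) + 1
  | mul a b => 2 * max (intLength a) (intLength b) + 3
  | div _ _ => 0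

/-- The syntactic length of a circuit over `ℚ`: the syntactic length of the division-free circuit that
is obtained from it by clearing denominators. -/
def syntacticLength (C : AlgCircuit V) : ℕ := intLength (clearDenoms C).1

end AlgCircuit

/-- `τ(M)`: the minimal size of a constant-free, division-free (and variable-free) circuit that
computes the integer `M`. -/
noncomputable def integerTau (M : ℤ) : ℕ :=
  sInf {k : ℕ | ∃ C : AlgCircuit Empty, C.DivFree ∧ C.poly = MvPolynomial.C (M : ℚ) ∧ C.size = k}

/-! ### The (boolean) Ideal Proof System -/

/-- The variables of an IPS proof from `m` equations in `n` variables: `x i`, the placeholders `y j` of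
the equations, and the placeholders `z i` of the boolean axioms `x_i ^ 2 - x_i = 0`. -/
inductive IPSVar (n m : ℕ) : Type
  | x (i : Fin n) : IPSVar n m
  | y (j : Fin m) : IPSVar n m
  | z (i : Fin n) : IPSVar n m

/-- Substitution of `0` for all placeholders. -/
noncomputable def ipsZero (n m : ℕ) : IPSVar n m → MvPolynomial (Fin n) ℚ
  | .x i => MvPolynomial.X i
  | .y _ => 0
  | .z _ => 0

/-- Substitution of the axioms for the placeholders. -/
noncomputable def ipsAxiom {n m : ℕ} (f : Fin m → MvPolynomial (Fin n) ℚ) :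
    IPSVar n m → MvPolynomial (Fin n) ℚ
  | .x i => MvPolynomial.X i
  | .y j => f j
  | .z i => MvPolynomial.X i ^ 2 - MvPolynomial.X i

/-- `R` is a constant-free (boolean) IPS proof over `ℚ` of `p = 0` from the equations `f j = 0`. -/
def IsIPSProof {n m : ℕ} (f : Fin m → MvPolynomial (Fin n) ℚ) (p : MvPolynomial (Fin n) ℚ)
    (R : AlgCircuit (IPSVar n m)) : Prop :=
  R.Valid ∧ MvPolynomial.bind₁ (ipsZero n m) R.poly = 0 ∧
    MvPolynomial.bind₁ (ipsAxiom f) R.poly = p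

/-- `R` is a constant-free (boolean) IPS refutation over `ℚ` of the equations `f j = 0`. -/
def IsIPSRefutation {n m : ℕ} (f : Fin m → MvPolynomial (Fin n) ℚ)
    (R : AlgCircuit (IPSVar n m)) : Prop :=
  IsIPSProof f 1 R

/-- The generalized binary value principle `x_1 + 2 x_2 + ⋯ + 2 ^ (t - 1) x_t + M = 0`, a system of one
equation (the variables are numbered from `0` here). -/
noncomputable def binaryValuePrinciple (t : ℕ) (M : ℤ) : Fin 1 → MvPolynomial (Fin t) ℚ :=
  fun _ => ∑ i : Fin t, MvPolynomial.C ((2 : ℚ) ^ (i : ℕ)) * MvPolynomial.X i +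
    MvPolynomial.C (M : ℚ)

/-! ### The (boolean) Cone Proof System for systems of equations -/

/-- The variables of a CPS refutation of `m` equations in `n` variables: `x i`, and one placeholder for
each of the inequalities `F_j ≥ 0`, `-F_j ≥ 0`, `x_i ^ 2 - x_i ≥ 0`, `-(x_i ^ 2 - x_i) ≥ 0`, `x_i ≥ 0`,
`1 - x_i ≥ 0`. -/
inductive CPSVar (n m : ℕ) : Type
  | x (i : Fin n) : CPSVar n m
  | eqPos (j : Fin m) : CPSVar n m
  | eqNeg (j : Fin m) : CPSVar n m
  | boolPos (i : Fin n) : CPSVar n m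
  | boolNeg (i : Fin n) : CPSVar n m
  | lower (i : Fin n) : CPSVar n m
  | upper (i : Fin n) : CPSVar n m

/-- The placeholder variables: all but the `x i`. -/
def cpsPlaceholders (n m : ℕ) : Set (CPSVar n m) := {v | ∀ i, v ≠ .x i}

open AlgCircuit in
/-- The circuits that are substituted for the placeholders. -/
def cpsAxiom {n m : ℕ} (F : Fin m → AlgCircuit (Fin n)) : CPSVar n m → AlgCircuit (Fin n)
  | .x i => var i
  | .eqPos j => F j
  | .eqNeg j => mul negOne (F j)
  | .boolPos i => add (mul (var i) (var i)) (mul negOne (var i))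
  | .boolNeg i => mul negOne (add (mul (var i) (var i)) (mul negOne (var i)))
  | .lower i => var i
  | .upper i => add one (mul negOne (var i))

/-- `C` is a constant-free (boolean) CPS refutation over `ℚ` of the equations `F j = 0`: a circuit
`C(x, y)` that is conic with respect to the placeholders and becomes `-1` when the axioms are
substituted for the placeholders. -/
def IsCPSRefutation {n m : ℕ} (F : Fin m → AlgCircuit (Fin n)) (C : AlgCircuit (CPSVar n m)) : Prop :=
  C.Valid ∧ C.Conic (cpsPlaceholders n m) ∧ (C.subst (cpsAxiom F)).poly = -1

/-!
An IPS proof of `p` from `f j = 0` is a circuit `R(x, y, z)` whose value in the ring `ℚ[x] ×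
ℚ[x]`, given by `(R(x, 0, 0), R(x, f, x ^ 2 - x))`, is `(0, p)`. So everything takes place in this
ring: a value with first component `0` is a *certificate* that its second component vanishes, and
sizes are counted by programs (`Program`), sets of circuits in which every computed value is
available for reuse.

A *bit* is a value `b` with a certificate of `b ^ 2 - b = 0`. With the sum bit `a + b - 2 a b` and
the carry `a b` of a half adder, the sum of the inputs *equals* the weighted sum of the outputs.
Hence unsigned numbers `b₀ + 2 b₁ + ⋯` can be added and multiplied without any error, only the
booleanity of the new bits has to be certified (`Program.IsNum.exists_add`,
`Program.IsNum.exists_mul`). It follows that the value of each gate of a division-free circuit is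
a difference of two unsigned numbers with at most `intLength - 1` bits (`exists_isSigned`), and
the square of such a difference is, up to a certificate, the square of an unsigned number
(`Program.IsSigned.exists_sq`).

Consider the CPS refutation after substitution of the axioms. Clearing denominators turns a gate
`g` into `M_g g` with an integer `M_g ≠ 0`. At a conic gate `g`, the number `|M_g| g` is an
unsigned number up to a certificate (`exists_isNonneg`): squares are treated as above, the axioms
are bits or have certificates of being zero, sums and products of unsigned numbers are unsigned,
and a divisor, being conic and without variables, is a positive constant. The absolute value of
`M_g` makes it unnecessary to keep track of the signs of denominators, which may well be negative
inside the `F_j`. At the output, which computes `-1`, this yields `t` certified bits with `b₀ + 2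
b₁ + ⋯ + |M| = 0`, again up to a certificate. Substitution of these bits and certificates into the
refutation of the binary value principle for `|M|` is a refutation of the given equations
(`exists_ipsRefutation_of_isNum`).
-/

open AlgCircuit

/-! ### Straight-line programs -/

/-- A straight-line program: a finite set of legitimate circuits that is closed under sub-circuits
and contains the constants `0, 1, -1`.  Its number of gates is the cardinality of the set, so that
results which have been computed once may be reused for free. -/
structure Program (V : Type) where
  /-- The circuits of the program. -/
  gates : Finset (AlgCircuit V)
  closed : ∀ c ∈ gates, c.nodes ⊆ gates
  valid : ∀ c ∈ gates, c.Valid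
  zero_mem : zero ∈ gates
  one_mem : one ∈ gates
  negOne_mem : negOne ∈ gates

namespace Program

variable {V A B : Type} [CommRing A] [CommRing B] {φ : MvPolynomial V ℚ →+* A × B}
variable {S S' S₁ S₂ : Program V} {k l w : ℕ} {a b c : A × B}

/-- `S'` arises from `S` by adding at most `k` gates. -/
def Extends (S : Program V) (k : ℕ) (S' : Program V) : Prop :=
  S.gates ⊆ S'.gates ∧ S'.gates.card ≤ S.gates.card + k

theorem Extends.refl (S : Program V) (k : ℕ) : S.Extends k S :=
  ⟨Finset.Subset.refl _, Nat.le_add_right _ _⟩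

theorem Extends.trans (h₁ : S.Extends k S₁) (h₂ : S₁.Extends l S₂) : S.Extends (k + l) S₂ :=
  ⟨h₁.1.trans h₂.1, by have := h₁.2; have := h₂.2; omega⟩

theorem Extends.mono (h : S.Extends k S') (hkl : k ≤ l) : S.Extends l S' :=
  ⟨h.1, h.2.trans (Nat.add_le_add_left hkl _)⟩

variable (φ) in
/-- Some gate of the program has the value `a` under `φ`. -/
def Computes (S : Program V) (a : A × B) : Prop := ∃ c ∈ S.gates, φ c.poly = a

theorem Computes.mono (h : Computes φ S a) (hS : S.gates ⊆ S'.gates) : Computes φ S' a := by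
  obtain ⟨c, hc, rfl⟩ := h
  exact ⟨c, hS hc, rfl⟩

theorem computes_zero : Computes φ S 0 := ⟨_, S.zero_mem, by simp [poly]⟩

theorem computes_one : Computes φ S 1 := ⟨_, S.one_mem, by simp [poly]⟩

theorem computes_negOne : Computes φ S (-1) := ⟨_, S.negOne_mem, by simp [poly]⟩

open Classical in
theorem exists_extends_gate (S : Program V) {c : AlgCircuit V} (hc : c.Valid)
    (hn : c.nodes ⊆ insert c S.gates) : ∃ S', S.Extends 1 S' ∧ c ∈ S'.gates := by
  refine ⟨⟨insert c S.gates, fun d hd => ?_, fun d hd => ?_, ?_, ?_, ?_⟩, ⟨?_, ?_⟩, ?_⟩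
  · rcases Finset.mem_insert.1 hd with rfl | hd
    · exact hn
    · exact (S.closed d hd).trans (Finset.subset_insert _ _)
  · rcases Finset.mem_insert.1 hd with rfl | hd
    · exact hc
    · exact S.valid d hd
  · exact Finset.mem_insert_of_mem S.zero_mem
  · exact Finset.mem_insert_of_mem S.one_mem
  · exact Finset.mem_insert_of_mem S.negOne_mem
  · exact Finset.subset_insert _ _
  · exact Finset.card_insert_le _ _
  · exact Finset.mem_insert_self _ _

theorem exists_computes_var (φ : MvPolynomial V ℚ →+* A × B) (S : Program V) (v : V) :
    ∃ S', S.Extends 1 S' ∧ Computes φ S' (φ (MvPolynomial.X v)) := by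
  classical
  obtain ⟨S', h, hc⟩ := S.exists_extends_gate (c := var v) trivial (by simp [nodes])
  exact ⟨S', h, _, hc, rfl⟩

theorem exists_computes_add (ha : Computes φ S a) (hb : Computes φ S b) :
    ∃ S', S.Extends 1 S' ∧ Computes φ S' (a + b) := by
  classical
  obtain ⟨c, hc, rfl⟩ := ha
  obtain ⟨d, hd, rfl⟩ := hb
  obtain ⟨S', h, hcd⟩ := S.exists_extends_gate (c := add c d) ⟨S.valid c hc, S.valid d hd⟩
    (Finset.insert_subset_insert _ (Finset.union_subset (S.closed c hc) (S.closed d hd)))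
  exact ⟨S', h, _, hcd, map_add φ _ _⟩

theorem exists_computes_mul (ha : Computes φ S a) (hb : Computes φ S b) :
    ∃ S', S.Extends 1 S' ∧ Computes φ S' (a * b) := by
  classical
  obtain ⟨c, hc, rfl⟩ := ha
  obtain ⟨d, hd, rfl⟩ := hb
  obtain ⟨S', h, hcd⟩ := S.exists_extends_gate (c := mul c d) ⟨S.valid c hc, S.valid d hd⟩
    (Finset.insert_subset_insert _ (Finset.union_subset (S.closed c hc) (S.closed d hd)))
  exact ⟨S', h, _, hcd, map_mul φ _ _⟩

variable (φ) in
/-- The value `a` can be computed by adding at most `k` gates to `S`, or to any larger program. -/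
def CostLE (S : Program V) (k : ℕ) (a : A × B) : Prop :=
  ∀ S' : Program V, S.gates ⊆ S'.gates → ∃ S'', S'.Extends k S'' ∧ Computes φ S'' a

theorem Computes.costLE (h : Computes φ S a) : CostLE φ S 0 a :=
  fun S' hS => ⟨S', .refl _ _, h.mono hS⟩

theorem CostLE.add (ha : CostLE φ S k a) (hb : CostLE φ S l b) :
    CostLE φ S (k + l + 1) (a + b) := fun S' hS => by
  obtain ⟨S₁, h₁, ha⟩ := ha S' hS
  obtain ⟨S₂, h₂, hb⟩ := hb S₁ (hS.trans h₁.1)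
  obtain ⟨S₃, h₃, hab⟩ := exists_computes_add (ha.mono h₂.1) hb
  exact ⟨S₃, (h₁.trans h₂).trans h₃, hab⟩

theorem CostLE.mul (ha : CostLE φ S k a) (hb : CostLE φ S l b) :
    CostLE φ S (k + l + 1) (a * b) := fun S' hS => by
  obtain ⟨S₁, h₁, ha⟩ := ha S' hS
  obtain ⟨S₂, h₂, hb⟩ := hb S₁ (hS.trans h₁.1)
  obtain ⟨S₃, h₃, hab⟩ := exists_computes_mul (ha.mono h₂.1) hb
  exact ⟨S₃, (h₁.trans h₂).trans h₃, hab⟩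

theorem CostLE.neg (ha : CostLE φ S k a) : CostLE φ S (k + 1) (-a) := by
  have := computes_negOne.costLE.mul ha
  rwa [neg_one_mul, zero_add] at this

theorem CostLE.sub (ha : CostLE φ S k a) (hb : CostLE φ S l b) :
    CostLE φ S (k + l + 2) (a - b) := by
  have := ha.add hb.neg
  rwa [← sub_eq_add_neg] at this

theorem CostLE.double (ha : CostLE φ S k a) : CostLE φ S (k + 2) (2 * a) := by
  have := (computes_one.costLE.add computes_one.costLE).mul ha
  rw [one_add_one_eq_two] at this
  convert this using 1
  omega

theorem CostLE.mono (ha : CostLE φ S k a) (hS : S.gates ⊆ S'.gates) : CostLE φ S' k a :=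
  fun S₁ h₁ => ha S₁ (hS.trans h₁)

theorem CostLE.exists_computes (ha : CostLE φ S k a) :
    ∃ S', S.Extends k S' ∧ Computes φ S' a := ha S (Finset.Subset.refl _)

theorem CostLE.one : CostLE φ S 0 1 := computes_one.costLE

theorem CostLE.two_pow (w : ℕ) : CostLE φ S (2 * w) (2 ^ w) := by
  induction w with
  | zero => simpa using CostLE.one
  | succ w ih => rw [pow_succ']; exact ih.double

/-! ### Binary arithmetic with certificates -/

variable (φ) in
/-- The value `b` is computed by `S` together with a certificate of booleanity: a value whose first
component is `0` and whose second component is that of `b ^ 2 - b`. -/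
def IsBit (S : Program V) (b : A × B) : Prop :=
  Computes φ S b ∧ ∃ z, Computes φ S z ∧ z.1 = 0 ∧ z.2 = b.2 ^ 2 - b.2

theorem IsBit.mono (h : IsBit φ S b) (hS : S.gates ⊆ S'.gates) : IsBit φ S' b := by
  obtain ⟨hb, z, hz, h⟩ := h
  exact ⟨hb.mono hS, z, hz.mono hS, h⟩

theorem isBit_zero : IsBit φ S 0 := ⟨computes_zero, 0, computes_zero, by simp⟩

theorem isBit_one : IsBit φ S 1 := ⟨computes_one, 0, computes_zero, by simp⟩

theorem CostLE.exists_isBit {z : A × B} (hb : CostLE φ S k b) (hz : CostLE φ S l z)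
    (h₁ : z.1 = 0) (h₂ : z.2 = b.2 ^ 2 - b.2) : ∃ S', S.Extends (k + l) S' ∧ IsBit φ S' b := by
  obtain ⟨S₁, e₁, hb⟩ := hb.exists_computes
  obtain ⟨S₂, e₂, hz⟩ := (hz.mono e₁.1).exists_computes
  exact ⟨S₂, e₁.trans e₂, hb.mono e₂.1, z, hz, h₁, h₂⟩

theorem IsBit.exists_not (hb : IsBit φ S b) : ∃ S', S.Extends 2 S' ∧ IsBit φ S' (1 - b) := by
  obtain ⟨hb, z, hz, h₁, h₂⟩ := hb
  refine (CostLE.one.sub hb.costLE).exists_isBit hz.costLE h₁ ?_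
  simp only [h₂, Prod.snd_sub, Prod.snd_one]
  ring

theorem IsBit.exists_and (ha : IsBit φ S a) (hb : IsBit φ S b) :
    ∃ S', S.Extends 6 S' ∧ IsBit φ S' (a * b) := by
  obtain ⟨ha, y, hy, hy₁, hy₂⟩ := ha
  obtain ⟨hb, z, hz, hz₁, hz₂⟩ := hb
  obtain ⟨S', e, h⟩ := (ha.costLE.mul hb.costLE).exists_isBit
    (((hy.costLE.mul hb.costLE).mul hb.costLE).add (ha.costLE.mul hz.costLE))
    (by simp [hy₁, hz₁]) (by simp only [hy₂, hz₂, Prod.snd_add, Prod.snd_mul]; ring)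
  exact ⟨S', e.mono (by norm_num), h⟩

theorem IsBit.exists_xor (ha : IsBit φ S a) (hb : IsBit φ S b) :
    ∃ S', S.Extends 16 S' ∧ IsBit φ S' (a + b - 2 * (a * b)) := by
  obtain ⟨ha, y, hy, hy₁, hy₂⟩ := ha
  obtain ⟨hb, z, hz, hz₁, hz₂⟩ := hb
  obtain ⟨S', e, h⟩ := ((ha.costLE.add hb.costLE).sub (ha.costLE.mul hb.costLE).double).exists_isBit
    ((hy.costLE.add hz.costLE).add (hy.costLE.mul hz.costLE).double.double)
    (by simp [hy₁, hz₁])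
    (by simp only [hy₂, hz₂, Prod.snd_add, Prod.snd_mul, Prod.snd_sub, Prod.snd_ofNat]; ring)
  exact ⟨S', e.mono (by norm_num), h⟩

/-- A full adder.  The sum of the two output bits, weighted by `1` and `2`, is *equal* to the sum of
the three input bits, and not only equal modulo certificates. -/
theorem IsBit.exists_fullAdder (ha : IsBit φ S a) (hb : IsBit φ S b) (hc : IsBit φ S c) :
    ∃ S', S.Extends 64 S' ∧ ∃ s d, IsBit φ S' s ∧ IsBit φ S' d ∧ a + b + c = s + 2 * d := by
  obtain ⟨S₁, e₁, hx⟩ := ha.exists_xor hb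
  obtain ⟨S₂, e₂, hs⟩ := hx.exists_xor (hc.mono e₁.1)
  have hx' := hx.mono e₂.1
  obtain ⟨ha, x, hx, hx₁, hx₂⟩ := ha.mono (e₁.1.trans e₂.1)
  obtain ⟨hb, y, hy, hy₁, hy₂⟩ := hb.mono (e₁.1.trans e₂.1)
  obtain ⟨hc, z, hz, hz₁, hz₂⟩ := hc.mono (e₁.1.trans e₂.1)
  obtain ⟨hu, t, ht, ht₁, ht₂⟩ := hx'
  -- The carry is `a * b + (a xor b) * c`, a sum of two bits whose product vanishes on booleans.
  have hab := ha.costLE.mul hb.costLE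
  have hd := hab.add (hu.costLE.mul hc.costLE)
  obtain ⟨S₃, e₃, hd⟩ := hd.exists_isBit
    ((((hx.costLE.mul hb.costLE).mul hb.costLE).add (ha.costLE.mul hy.costLE)).add
      ((((ht.costLE.mul hc.costLE).mul hc.costLE).add (hu.costLE.mul hz.costLE)).add
        (hc.costLE.mul (((hx.costLE.mul hb.costLE).sub (ha.costLE.mul hy.costLE)).sub
          ((hx.costLE.mul hb.costLE).mul hb.costLE).double)).double))
    (by simp [hx₁, hy₁, hz₁, ht₁])
    (by
      simp only [hx₂, hy₂, hz₂, ht₂, Prod.snd_add, Prod.snd_mul, Prod.snd_sub, Prod.snd_ofNat]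
      ring)
  exact ⟨S₃, ((e₁.trans e₂).trans e₃).mono (by norm_num), _, _, hs.mono e₃.1, hd, by ring⟩

variable (φ) in
/-- The value `v` is an unsigned `w`-bit integer: there are bits `b₀, …, b_{w-1}`, computed by `S`
with certificates of booleanity, such that `v = b₀ + 2 b₁ + ⋯ + 2 ^ (w - 1) b_{w-1}`. -/
def IsNum (S : Program V) : ℕ → A × B → Prop
  | 0, v => v = 0
  | w + 1, v => ∃ b u, IsBit φ S b ∧ IsNum S w u ∧ v = b + 2 * u

theorem IsNum.mono (h : IsNum φ S w a) (hS : S.gates ⊆ S'.gates) : IsNum φ S' w a := by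
  induction w generalizing a with
  | zero => exact h
  | succ w ih =>
    obtain ⟨b, u, hb, hu, rfl⟩ := h
    exact ⟨b, u, hb.mono hS, ih hu, rfl⟩

theorem isNum_zero (w : ℕ) : IsNum φ S w 0 := by
  induction w with
  | zero => rfl
  | succ w ih => exact ⟨0, 0, isBit_zero, ih, by simp⟩

theorem IsNum.mono_width (h : IsNum φ S w a) (hl : w ≤ l) : IsNum φ S l a := by
  induction w generalizing a l with
  | zero => cases h; exact isNum_zero l
  | succ w ih =>
    obtain ⟨b, u, hb, hu, rfl⟩ := h
    obtain ⟨l, rfl⟩ : ∃ j, l = j + 1 := ⟨l - 1, by omega⟩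
    exact ⟨b, u, hb, ih hu (by omega), rfl⟩

theorem IsBit.isNum (h : IsBit φ S b) : IsNum φ S 1 b := ⟨b, 0, h, rfl, by simp⟩

theorem isNum_natCast {x : ℕ} (hx : x < 2 ^ w) : IsNum φ S w (x : A × B) := by
  induction w generalizing x with
  | zero => obtain rfl : x = 0 := by simpa using hx
            simp [IsNum]
  | succ w ih =>
    refine ⟨((x % 2 : ℕ) : A × B), ((x / 2 : ℕ) : A × B), ?_, ih (by rw [pow_succ] at hx; omega), ?_⟩
    · rcases Nat.mod_two_eq_zero_or_one x with h | h <;> rw [h]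
      · simpa using isBit_zero
      · simpa using isBit_one
    · have := Nat.mod_add_div x 2
      exact_mod_cast congrArg (Nat.cast (R := A × B)) this.symm

theorem IsNum.costLE (h : IsNum φ S w a) : CostLE φ S (3 * w) a := by
  induction w generalizing a with
  | zero => cases h; exact computes_zero.costLE
  | succ w ih =>
    obtain ⟨b, u, hb, hu, rfl⟩ := h
    have := hb.1.costLE.add (ih hu).double
    convert this using 1
    omega

/-- The most significant bit of a number. -/
theorem IsNum.exists_msb (h : IsNum φ S (w + 1) a) :
    ∃ b u, IsBit φ S b ∧ IsNum φ S w u ∧ a = u + 2 ^ w * b := by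
  induction w generalizing a with
  | zero =>
    obtain ⟨b, u, hb, rfl, rfl⟩ := h
    exact ⟨b, 0, hb, rfl, by simp⟩
  | succ w ih =>
    obtain ⟨b, u, hb, hu, rfl⟩ := h
    obtain ⟨t, v, ht, hv, rfl⟩ := ih hu
    exact ⟨t, b + 2 * v, ht, ⟨b, v, hb, hv, rfl⟩, by ring⟩

/-- The ripple-carry adder. -/
theorem IsNum.exists_add_add (ha : IsNum φ S w a) (hb : IsNum φ S w b) (hc : IsBit φ S c) :
    ∃ S', S.Extends (64 * w) S' ∧ IsNum φ S' (w + 1) (a + b + c) := by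
  induction w generalizing S a b c with
  | zero =>
    cases ha; cases hb
    exact ⟨S, .refl _ _, by simpa using hc.isNum⟩
  | succ w ih =>
    obtain ⟨p, u, hp, hu, rfl⟩ := ha
    obtain ⟨q, v, hq, hv, rfl⟩ := hb
    obtain ⟨S₁, e₁, s, d, hs, hd, h⟩ := hp.exists_fullAdder hq hc
    obtain ⟨S₂, e₂, hn⟩ := ih (hu.mono e₁.1) (hv.mono e₁.1) hd
    refine ⟨S₂, (e₁.trans e₂).mono (by omega), s, _, hs.mono e₂.1, hn, ?_⟩
    linear_combination h

theorem IsNum.exists_add (ha : IsNum φ S w a) (hb : IsNum φ S w b) :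
    ∃ S', S.Extends (64 * w) S' ∧ IsNum φ S' (w + 1) (a + b) := by
  simpa using ha.exists_add_add hb isBit_zero

theorem IsNum.exists_bit_mul (ha : IsNum φ S w a) (hb : IsBit φ S b) :
    ∃ S', S.Extends (6 * w) S' ∧ IsNum φ S' w (b * a) := by
  induction w generalizing S a with
  | zero => cases ha; exact ⟨S, .refl _ _, by simp [IsNum]⟩
  | succ w ih =>
    obtain ⟨p, u, hp, hu, rfl⟩ := ha
    obtain ⟨S₁, e₁, hc⟩ := hb.exists_and hp
    obtain ⟨S₂, e₂, hn⟩ := ih (hu.mono e₁.1) (hb.mono e₁.1)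
    exact ⟨S₂, (e₁.trans e₂).mono (by omega), _, _, hc.mono e₂.1, hn, by ring⟩

/-- Multiplication with accumulation, by which the product of a `w`-bit and an `l`-bit number has
`w + l` bits. -/
theorem IsNum.exists_mul_add (ha : IsNum φ S w a) (hb : IsNum φ S l b) (hc : IsNum φ S w c) :
    ∃ S', S.Extends (70 * w * l) S' ∧ IsNum φ S' (w + l) (a * b + c) := by
  induction l generalizing S b c with
  | zero => cases hb; exact ⟨S, .refl _ _, by simpa using hc⟩
  | succ l ih =>
    obtain ⟨q, v, hq, hv, rfl⟩ := hb
    obtain ⟨S₁, e₁, h₁⟩ := ha.exists_bit_mul hq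
    obtain ⟨S₂, e₂, s, d, hs, hd, h⟩ := h₁.exists_add (hc.mono e₁.1)
    have e := e₁.trans e₂
    obtain ⟨S₃, e₃, hn⟩ := ih (ha.mono e.1) (hv.mono e.1) hd
    refine ⟨S₃, (e.trans e₃).mono (by ring_nf; omega), s, _, hs.mono e₃.1, hn, ?_⟩
    linear_combination h

theorem IsNum.exists_mul (ha : IsNum φ S w a) (hb : IsNum φ S l b) :
    ∃ S', S.Extends (70 * w * l) S' ∧ IsNum φ S' (w + l) (a * b) := by
  simpa using ha.exists_mul_add hb (isNum_zero w)

theorem IsNum.exists_compl (ha : IsNum φ S w a) :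
    ∃ S', S.Extends (2 * w) S' ∧ IsNum φ S' w (2 ^ w - 1 - a) := by
  induction w generalizing S a with
  | zero => cases ha; exact ⟨S, .refl _ _, by simp [IsNum]⟩
  | succ w ih =>
    obtain ⟨p, u, hp, hu, rfl⟩ := ha
    obtain ⟨S₁, e₁, hc⟩ := hp.exists_not
    obtain ⟨S₂, e₂, hn⟩ := ih (hu.mono e₁.1)
    exact ⟨S₂, (e₁.trans e₂).mono (by omega), _, _, hc.mono e₂.1, hn, by ring⟩

/-- Complementing all bits of `a` if the bit `b` is set. -/
theorem IsNum.exists_xor (ha : IsNum φ S w a) (hb : IsBit φ S b) :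
    ∃ S', S.Extends (16 * w) S' ∧ IsNum φ S' w (a + b * (2 ^ w - 1 - 2 * a)) := by
  induction w generalizing S a with
  | zero => cases ha; exact ⟨S, .refl _ _, by simp [IsNum]⟩
  | succ w ih =>
    obtain ⟨p, u, hp, hu, rfl⟩ := ha
    obtain ⟨S₁, e₁, hc⟩ := hp.exists_xor hb
    obtain ⟨S₂, e₂, hn⟩ := ih (hu.mono e₁.1) (hb.mono e₁.1)
    exact ⟨S₂, (e₁.trans e₂).mono (by omega), _, _, hc.mono e₂.1, hn, by ring⟩

/-- The absolute value `m` of the difference of two unsigned integers, with a certificate of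
`m ^ 2 = (a - b) ^ 2`. -/
theorem IsNum.exists_abs_sub (ha : IsNum φ S w a) (hb : IsNum φ S w b) :
    ∃ S', S.Extends (170 * w + 20) S' ∧ ∃ m e, IsNum φ S' (w + 1) m ∧ Computes φ S' e ∧
      e.1 = 0 ∧ e.2 = (a.2 - b.2) ^ 2 - m.2 ^ 2 := by
  obtain ⟨S₁, e₁, hb⟩ := hb.exists_compl
  obtain ⟨S₂, e₂, h⟩ := (ha.mono e₁.1).exists_add_add hb isBit_one
  -- `a - b + 2 ^ w = u + 2 ^ w * τ`; the difference is negative if and only if `τ = 0`.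
  obtain ⟨τ, u, hτ, hu, h⟩ := h.exists_msb
  obtain ⟨S₃, e₃, hn⟩ := hτ.exists_not
  obtain ⟨S₄, e₄, hx⟩ := (hu.mono e₃.1).exists_xor hn
  obtain ⟨S₅, e₅, hm⟩ := hx.exists_add_add (isNum_zero w) (hn.mono e₄.1)
  obtain ⟨-, z, hz, hz₁, hz₂⟩ := hτ.mono ((e₃.trans e₄).trans e₅).1
  have hu := (hu.mono ((e₃.trans e₄).trans e₅).1).costLE
  have hp := CostLE.two_pow (φ := φ) (S := S₅) w
  have hq := hp.sub hu.double
  obtain ⟨S₆, e₆, he⟩ := (hz.costLE.mul ((hp.mul hp).sub (hq.mul hq))).exists_computes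
  refine ⟨S₆, (((((e₁.trans e₂).trans e₃).trans e₄).trans e₅).trans e₆).mono (by omega), _, _,
    hm.mono e₆.1, he, by simp [hz₁], ?_⟩
  have h := congrArg Prod.snd h
  simp only [hz₂, Prod.snd_add, Prod.snd_mul, Prod.snd_sub, Prod.snd_ofNat, Prod.snd_one,
    Prod.pow_snd, Prod.snd_zero] at h ⊢
  rw [show a.2 - b.2 = u.2 - 2 ^ w * (1 - τ.2) by linear_combination h]
  ring

variable (φ) in
/-- The element `v` is the difference of two unsigned `w`-bit integers. -/
def IsSigned (S : Program V) (w : ℕ) (v : B) : Prop :=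
  ∃ a b, IsNum φ S w a ∧ IsNum φ S w b ∧ v = a.2 - b.2

variable (φ) in
/-- The element `v` is provably a nonnegative `w`-bit integer: it is the sum of an unsigned `w`-bit
integer `p` and of an element `e` for which there is a certificate of `e = 0`. -/
def IsNonneg (S : Program V) (w : ℕ) (v : B) : Prop :=
  ∃ p e, IsNum φ S w p ∧ Computes φ S p ∧ Computes φ S e ∧ e.1 = 0 ∧ v = p.2 + e.2

variable {u v : B}

theorem IsSigned.mono (h : IsSigned φ S w v) (hS : S.gates ⊆ S'.gates) : IsSigned φ S' w v := by
  obtain ⟨a, b, ha, hb, h⟩ := h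
  exact ⟨a, b, ha.mono hS, hb.mono hS, h⟩

theorem IsSigned.mono_width (h : IsSigned φ S w v) (hl : w ≤ l) : IsSigned φ S l v := by
  obtain ⟨a, b, ha, hb, h⟩ := h
  exact ⟨a, b, ha.mono_width hl, hb.mono_width hl, h⟩

theorem IsNonneg.mono (h : IsNonneg φ S w v) (hS : S.gates ⊆ S'.gates) : IsNonneg φ S' w v := by
  obtain ⟨p, e, hp, hp', he, h⟩ := h
  exact ⟨p, e, hp.mono hS, hp'.mono hS, he.mono hS, h⟩

theorem IsNonneg.mono_width (h : IsNonneg φ S w v) (hl : w ≤ l) : IsNonneg φ S l v := by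
  obtain ⟨p, e, hp, h⟩ := h
  exact ⟨p, e, hp.mono_width hl, h⟩

theorem IsSigned.exists_add (hu : IsSigned φ S w u) (hv : IsSigned φ S w v) :
    ∃ S', S.Extends (128 * w) S' ∧ IsSigned φ S' (w + 1) (u + v) := by
  obtain ⟨a, b, ha, hb, rfl⟩ := hu
  obtain ⟨c, d, hc, hd, rfl⟩ := hv
  obtain ⟨S₁, e₁, h₁⟩ := ha.exists_add hc
  obtain ⟨S₂, e₂, h₂⟩ := (hb.mono e₁.1).exists_add (hd.mono e₁.1)
  exact ⟨S₂, (e₁.trans e₂).mono (by omega), _, _, h₁.mono e₂.1, h₂, by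
    simp only [Prod.snd_add]; ring⟩

theorem IsSigned.exists_mul (hu : IsSigned φ S w u) (hv : IsSigned φ S w v) :
    ∃ S', S.Extends (280 * w * w + 256 * w) S' ∧ IsSigned φ S' (2 * w + 1) (u * v) := by
  obtain ⟨a, b, ha, hb, rfl⟩ := hu
  obtain ⟨c, d, hc, hd, rfl⟩ := hv
  obtain ⟨S₁, e₁, h₁⟩ := ha.exists_mul hc
  obtain ⟨S₂, e₂, h₂⟩ := (hb.mono e₁.1).exists_mul (hd.mono e₁.1)
  have e := e₁.trans e₂
  obtain ⟨S₃, e₃, h₃⟩ := (ha.mono e.1).exists_mul (hd.mono e.1)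
  have e := e.trans e₃
  obtain ⟨S₄, e₄, h₄⟩ := (hb.mono e.1).exists_mul (hc.mono e.1)
  obtain ⟨S₅, e₅, h₅⟩ := (h₁.mono ((e₂.trans e₃).trans e₄).1).exists_add
    (h₂.mono (e₃.trans e₄).1)
  obtain ⟨S₆, e₆, h₆⟩ := (h₃.mono (e₄.trans e₅).1).exists_add (h₄.mono e₅.1)
  rw [← two_mul] at h₅ h₆
  refine ⟨S₆, (((e.trans e₄).trans e₅).trans e₆).mono (le_of_eq (by ring)), _, _,
    h₅.mono e₆.1, h₆, ?_⟩
  simp only [Prod.snd_add, Prod.snd_mul]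
  ring

theorem IsSigned.exists_sq (hv : IsSigned φ S w v) :
    ∃ S', S.Extends (70 * (w + 1) * (w + 1) + 180 * w + 40) S' ∧
      IsNonneg φ S' (2 * w + 2) (v * v) := by
  obtain ⟨a, b, ha, hb, rfl⟩ := hv
  obtain ⟨S₁, e₁, m, e, hm, he, he₁, he₂⟩ := ha.exists_abs_sub hb
  obtain ⟨S₂, e₂, hp⟩ := hm.exists_mul hm
  obtain ⟨S₃, e₃, hc⟩ := hp.costLE.exists_computes
  refine ⟨S₃, ((e₁.trans e₂).trans e₃).mono (by omega), _, e, (hp.mono e₃.1).mono_width (by omega),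
    hc, he.mono (e₂.trans e₃).1, he₁, ?_⟩
  rw [he₂, Prod.snd_mul]
  ring

theorem IsNonneg.exists_add (hu : IsNonneg φ S w u) (hv : IsNonneg φ S w v) :
    ∃ S', S.Extends (64 * w + 2) S' ∧ IsNonneg φ S' (w + 1) (u + v) := by
  obtain ⟨p, d, hp, hp', hd, hd₁, rfl⟩ := hu
  obtain ⟨q, e, hq, hq', he, he₁, rfl⟩ := hv
  obtain ⟨S₁, e₁, h⟩ := hp.exists_add hq
  obtain ⟨S₂, e₂, h₂⟩ := ((hp'.costLE.add hq'.costLE).mono e₁.1).exists_computes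
  obtain ⟨S₃, e₃, h₃⟩ := ((hd.costLE.add he.costLE).mono (e₁.trans e₂).1).exists_computes
  refine ⟨S₃, ((e₁.trans e₂).trans e₃).mono (by omega), _, _, h.mono (e₂.trans e₃).1,
    h₂.mono e₃.1, h₃, by simp [hd₁, he₁], ?_⟩
  simp only [Prod.snd_add]
  ring

theorem IsNonneg.exists_mul (hu : IsNonneg φ S w u) (hv : IsNonneg φ S w v) :
    ∃ S', S.Extends (70 * w * w + 5) S' ∧ IsNonneg φ S' (2 * w) (u * v) := by
  obtain ⟨p, d, hp, hp', hd, hd₁, rfl⟩ := hu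
  obtain ⟨q, e, hq, hq', he, he₁, rfl⟩ := hv
  obtain ⟨S₁, e₁, h⟩ := hp.exists_mul hq
  obtain ⟨S₂, e₂, h₂⟩ := ((hp'.costLE.mul hq'.costLE).mono e₁.1).exists_computes
  obtain ⟨S₃, e₃, h₃⟩ := (((hd.costLE.mul (hq'.costLE.add he.costLE)).add
    (hp'.costLE.mul he.costLE)).mono (e₁.trans e₂).1).exists_computes
  refine ⟨S₃, ((e₁.trans e₂).trans e₃).mono (by omega), _, _,
    (h.mono (e₂.trans e₃).1).mono_width (by omega),
    h₂.mono e₃.1, h₃, by simp [hd₁, he₁], ?_⟩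
  simp only [Prod.snd_add, Prod.snd_mul]
  ring

theorem exists_isNonneg_natCast (φ : MvPolynomial V ℚ →+* A × B) (S : Program V) {x : ℕ}
    (hx : x < 2 ^ w) : ∃ S', S.Extends (3 * w) S' ∧ IsNonneg φ S' w (x : B) := by
  have h : IsNum φ S w (x : A × B) := isNum_natCast hx
  obtain ⟨S₁, e₁, h₁⟩ := h.costLE.exists_computes
  exact ⟨S₁, e₁, _, 0, h.mono e₁.1, h₁, computes_zero, rfl, by simp⟩

theorem IsBit.isNonneg (hb : IsBit φ S b) : IsNonneg φ S 1 b.2 :=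
  ⟨b, 0, hb.isNum, hb.1, computes_zero, rfl, by simp⟩

theorem Computes.isNonneg (ha : Computes φ S a) (h : a.1 = 0) (w : ℕ) : IsNonneg φ S w a.2 :=
  ⟨0, a, isNum_zero w, computes_zero, ha, h, by simp⟩

/-- The bits of a number, listed. -/
theorem IsNum.exists_bits (h : IsNum φ S w a) :
    ∃ b : Fin w → A × B, (∀ i, IsBit φ S (b i)) ∧ a = ∑ i : Fin w, 2 ^ (i : ℕ) * b i := by
  induction w generalizing a with
  | zero => cases h; exact ⟨Fin.elim0, fun i => i.elim0, by simp⟩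
  | succ w ih =>
    obtain ⟨b, u, hb, hu, rfl⟩ := h
    obtain ⟨f, hf, rfl⟩ := ih hu
    refine ⟨Fin.cons b f, Fin.cases hb hf, ?_⟩
    simp [Fin.sum_univ_succ, Finset.mul_sum, pow_succ', mul_assoc]

end Program

/-! ### Nodes and substitution -/

namespace AlgCircuit

variable {V W : Type}

theorem self_mem_nodes (C : AlgCircuit V) : C ∈ C.nodes := by
  cases C <;> simp [nodes]

theorem nodes_subset_of_mem {C E : AlgCircuit V} (h : E ∈ C.nodes) : E.nodes ⊆ C.nodes := by
  classical
  induction C with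
  | var | zero | one | negOne => simp only [nodes, Finset.mem_singleton] at h; subst h; rfl
  | add a b iha ihb | mul a b iha ihb | div a b iha ihb =>
    simp only [nodes, Finset.mem_insert, Finset.mem_union] at h ⊢
    rcases h with rfl | h | h
    · rfl
    · exact (iha h).trans fun x hx => by simp [hx]
    · exact (ihb h).trans fun x hx => by simp [hx]

theorem sizeOf_lt_of_mem_nodes {C E : AlgCircuit V} (h : E ∈ C.nodes) (hne : E ≠ C) :
    sizeOf E < sizeOf C := by
  classical
  induction C with
  | var | zero | one | negOne => simp only [nodes, Finset.mem_singleton] at h; exact absurd h hne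
  | add a b iha ihb | mul a b iha ihb | div a b iha ihb =>
    simp only [nodes, Finset.mem_insert, Finset.mem_union] at h
    have key : sizeOf E ≤ sizeOf a ∨ sizeOf E ≤ sizeOf b := by
      rcases h with h | h | h
      · exact absurd h hne
      · left; by_cases e : E = a
        · rw [e]
        · exact (iha h e).le
      · right; by_cases e : E = b
        · rw [e]
        · exact (ihb h e).le
    simp only [add.sizeOf_spec, mul.sizeOf_spec, div.sizeOf_spec]
    omega

theorem left_mem_nodes_add (a b : AlgCircuit V) : a ∈ (add a b).nodes := by
  simp [nodes, self_mem_nodes]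

theorem right_mem_nodes_add (a b : AlgCircuit V) : b ∈ (add a b).nodes := by
  simp [nodes, self_mem_nodes]

theorem left_mem_nodes_mul (a b : AlgCircuit V) : a ∈ (mul a b).nodes := by
  simp [nodes, self_mem_nodes]

theorem right_mem_nodes_mul (a b : AlgCircuit V) : b ∈ (mul a b).nodes := by
  simp [nodes, self_mem_nodes]

theorem left_mem_nodes_div (a b : AlgCircuit V) : a ∈ (div a b).nodes := by
  simp [nodes, self_mem_nodes]

theorem Valid.of_mem_nodes {C E : AlgCircuit V} (hC : C.Valid) (h : E ∈ C.nodes) : E.Valid := by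
  classical
  induction C with
  | var | zero | one | negOne => simp only [nodes, Finset.mem_singleton] at h; exact h ▸ hC
  | add a b iha ihb | mul a b iha ihb =>
    simp only [nodes, Finset.mem_insert, Finset.mem_union] at h
    rcases h with rfl | h | h
    exacts [hC, iha hC.1 h, ihb hC.2 h]
  | div a b iha ihb =>
    simp only [nodes, Finset.mem_insert, Finset.mem_union] at h
    rcases h with rfl | h | h
    exacts [hC, iha hC.1 h, ihb hC.2.1 h]

theorem DivFree.of_mem_nodes {C E : AlgCircuit V} (hC : C.DivFree) (h : E ∈ C.nodes) :
    E.DivFree := by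
  classical
  induction C with
  | var | zero | one | negOne => simp only [nodes, Finset.mem_singleton] at h; exact h ▸ hC
  | add a b iha ihb | mul a b iha ihb =>
    simp only [nodes, Finset.mem_insert, Finset.mem_union] at h
    rcases h with rfl | h | h
    exacts [hC, iha hC.1 h, ihb hC.2 h]
  | div => exact hC.elim

theorem DivFree.valid {C : AlgCircuit V} (hC : C.DivFree) : C.Valid := by
  induction C with
  | var | zero | one | negOne => trivial
  | add a b iha ihb | mul a b iha ihb => exact ⟨iha hC.1, ihb hC.2⟩
  | div => exact hC.elim

/-- The value of a circuit without variables, in form of a constant polynomial. -/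
theorem VarFree.poly_eq {C : AlgCircuit V} (hC : C.VarFree) :
    C.poly = MvPolynomial.C (MvPolynomial.constantCoeff C.poly) := by
  induction C with
  | var => exact hC.elim
  | zero | one | negOne => simp [poly]
  | add a b iha ihb => rw [poly, map_add, map_add, ← iha hC.1, ← ihb hC.2]
  | mul a b iha ihb => rw [poly, map_mul, map_mul, ← iha hC.1, ← ihb hC.2]
  | div a b iha ihb =>
    rw [poly, map_mul, map_mul, ← iha hC.1, MvPolynomial.constantCoeff_C]

theorem VarFree.constantCoeff_ne_zero {C : AlgCircuit V} (hC : C.VarFree) (h : C.poly ≠ 0) :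
    MvPolynomial.constantCoeff C.poly ≠ 0 := fun h0 => h (by rw [hC.poly_eq, h0, map_zero])

theorem VarFree.subst {C : AlgCircuit V} (h : V → AlgCircuit W) (hC : C.VarFree) :
    (C.subst h).VarFree := by
  induction C with
  | var => exact hC.elim
  | zero | one | negOne => trivial
  | add a b iha ihb | mul a b iha ihb | div a b iha ihb => exact ⟨iha hC.1, ihb hC.2⟩

theorem DivFree.subst {C : AlgCircuit V} {h : V → AlgCircuit W} (hh : ∀ v, (h v).DivFree)
    (hC : C.DivFree) : (C.subst h).DivFree := by
  induction C with
  | var v => exact hh v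
  | zero | one | negOne => trivial
  | add a b iha ihb | mul a b iha ihb => exact ⟨iha hC.1, ihb hC.2⟩
  | div => exact hC.elim

theorem Valid.poly_subst {C : AlgCircuit V} (h : V → AlgCircuit W) (hC : C.Valid) :
    (C.subst h).poly = MvPolynomial.bind₁ (fun v => (h v).poly) C.poly := by
  induction C with
  | var v => simp [AlgCircuit.subst, poly]
  | zero | one | negOne => simp [AlgCircuit.subst, poly]
  | add a b iha ihb => simp [AlgCircuit.subst, poly, iha hC.1, ihb hC.2]
  | mul a b iha ihb => simp [AlgCircuit.subst, poly, iha hC.1, ihb hC.2]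
  | div a b iha ihb =>
    rw [AlgCircuit.subst, poly, poly, iha hC.1, ihb hC.2.1, map_mul, hC.2.2.1.poly_eq]
    simp

theorem Valid.subst {C : AlgCircuit V} {h : V → AlgCircuit W} (hh : ∀ v, (h v).Valid)
    (hC : C.Valid) : (C.subst h).Valid := by
  induction C with
  | var v => exact hh v
  | zero | one | negOne => trivial
  | add a b iha ihb | mul a b iha ihb => exact ⟨iha hC.1, ihb hC.2⟩
  | div a b iha ihb =>
    obtain ⟨ha, hb, hv, h0⟩ := hC
    refine ⟨iha ha, ihb hb, hv.subst h, ?_⟩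
    rw [hb.poly_subst, hv.poly_eq, MvPolynomial.bind₁_C_right]
    simpa using hv.constantCoeff_ne_zero h0

open Classical in
theorem nodes_subst_subset {C : AlgCircuit V} {h : V → AlgCircuit W} {T : Finset (AlgCircuit W)}
    (hT : ∀ v, var v ∈ C.nodes → (h v).nodes ⊆ T) :
    (C.subst h).nodes ⊆ C.nodes.image (subst h) ∪ T := by
  induction C with
  | var v => exact (hT v (self_mem_nodes _)).trans Finset.subset_union_right
  | zero | one | negOne => simp [AlgCircuit.subst, nodes]
  | add a b iha ihb | mul a b iha ihb | div a b iha ihb =>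
    have ha := iha fun v hv => hT v (by simp [nodes, hv])
    have hb := ihb fun v hv => hT v (by simp [nodes, hv])
    simp only [AlgCircuit.subst, nodes, Finset.image_insert, Finset.image_union]
    refine Finset.insert_subset (by simp) (Finset.union_subset (ha.trans ?_) (hb.trans ?_)) <;>
    · intro x
      simp only [Finset.mem_union, Finset.mem_insert]
      tauto

theorem subst_mem_nodes_subst {C E : AlgCircuit V} (h : V → AlgCircuit W) (hE : E ∈ C.nodes) :
    E.subst h ∈ (C.subst h).nodes := by
  classical
  induction C with
  | var | zero | one | negOne =>
    simp only [nodes, Finset.mem_singleton] at hE; subst hE; exact self_mem_nodes _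
  | add a b iha ihb | mul a b iha ihb | div a b iha ihb =>
    simp only [nodes, Finset.mem_insert, Finset.mem_union] at hE
    rcases hE with rfl | hE | hE
    · exact self_mem_nodes _
    · simp [AlgCircuit.subst, nodes, iha hE]
    · simp [AlgCircuit.subst, nodes, ihb hE]

theorem size_pos (C : AlgCircuit V) : 0 < C.size := Finset.card_pos.2 ⟨C, self_mem_nodes C⟩

/-! ### Clearing denominators -/

/-- The number by which a multiplier multiplies, `none` being the trivial multiplier. -/
noncomputable def multiplierValue : Option (AlgCircuit V) → ℚ
  | none => 1
  | some l => MvPolynomial.constantCoeff l.poly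

/-- The number `M` by which the polynomial of a circuit is multiplied if denominators are cleared. -/
noncomputable def denom (C : AlgCircuit V) : ℚ := multiplierValue (clearDenoms C).2

theorem multiplierValue_mulMultiplier (k l : Option (AlgCircuit V)) :
    multiplierValue (mulMultiplier k l) = multiplierValue k * multiplierValue l := by
  cases k <;> cases l <;> simp [mulMultiplier, multiplierValue, scale, poly]

theorem poly_scale {k : Option (AlgCircuit V)} (hk : ∀ l ∈ k, VarFree l) (a : AlgCircuit V) :
    (scale k a).poly = MvPolynomial.C (multiplierValue k) * a.poly := by
  cases k with
  | none => simp [scale, multiplierValue]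
  | some l => rw [scale, poly, (hk l rfl).poly_eq, multiplierValue]

theorem varFree_scale {k : Option (AlgCircuit V)} {a : AlgCircuit V} (hk : ∀ l ∈ k, VarFree l)
    (ha : VarFree a) : VarFree (scale k a) := by
  cases k with
  | none => exact ha
  | some l => exact ⟨hk l rfl, ha⟩

theorem varFree_mulMultiplier {k l : Option (AlgCircuit V)} (hk : ∀ u ∈ k, VarFree u)
    (hl : ∀ u ∈ l, VarFree u) : ∀ u ∈ mulMultiplier k l, VarFree u := by
  intro u hu
  cases l with
  | none => exact hk u hu
  | some l =>
    cases hu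
    exact varFree_scale hk (hl l rfl)

theorem Valid.varFree_clearDenoms {C : AlgCircuit V} (hC : C.Valid) :
    (C.VarFree → (clearDenoms C).1.VarFree) ∧ ∀ l ∈ (clearDenoms C).2, VarFree l := by
  induction C with
  | var | zero | one | negOne => exact ⟨id, fun l hl => by cases hl⟩
  | add a b iha ihb =>
    obtain ⟨ha, ha'⟩ := iha hC.1
    obtain ⟨hb, hb'⟩ := ihb hC.2
    exact ⟨fun h => ⟨varFree_scale hb' (ha h.1), varFree_scale ha' (hb h.2)⟩,
      varFree_mulMultiplier ha' hb'⟩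
  | mul a b iha ihb =>
    obtain ⟨ha, ha'⟩ := iha hC.1
    obtain ⟨hb, hb'⟩ := ihb hC.2
    exact ⟨fun h => ⟨ha h.1, hb h.2⟩, varFree_mulMultiplier ha' hb'⟩
  | div a b iha ihb =>
    obtain ⟨ha, ha'⟩ := iha hC.1
    obtain ⟨hb, hb'⟩ := ihb hC.2.1
    refine ⟨fun h => varFree_scale hb' (ha h.1), fun l hl => ?_⟩
    cases hl
    exact varFree_scale ha' (hb hC.2.2.1)

theorem denom_add (a b : AlgCircuit V) : denom (add a b) = denom a * denom b :=
  multiplierValue_mulMultiplier _ _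

theorem denom_mul (a b : AlgCircuit V) : denom (mul a b) = denom a * denom b :=
  multiplierValue_mulMultiplier _ _

/-- Clearing denominators multiplies the polynomial of the circuit by `denom`. -/
theorem Valid.poly_clearDenoms {C : AlgCircuit V} (hC : C.Valid) :
    (clearDenoms C).1.poly = MvPolynomial.C (denom C) * C.poly := by
  induction C with
  | var | zero | one | negOne => simp [clearDenoms, denom, multiplierValue]
  | add a b iha ihb =>
    rw [denom_add, clearDenoms, poly, poly_scale hC.2.varFree_clearDenoms.2,
      poly_scale hC.1.varFree_clearDenoms.2, iha hC.1, ihb hC.2, poly, map_mul, denom, denom]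
    ring
  | mul a b iha ihb =>
    rw [denom_mul, clearDenoms, poly, iha hC.1, ihb hC.2, poly, map_mul]
    ring
  | div a b iha ihb =>
    have h0 := hC.2.2.1.constantCoeff_ne_zero hC.2.2.2
    rw [denom, clearDenoms, multiplierValue, poly_scale hC.2.1.varFree_clearDenoms.2,
      poly_scale hC.1.varFree_clearDenoms.2, iha hC.1, ihb hC.2.1, poly, ← mul_assoc,
      ← mul_assoc, ← map_mul, ← map_mul]
    congr 2
    simp only [map_mul, MvPolynomial.constantCoeff_C, denom]
    field_simp

theorem Valid.denom_div {a b : AlgCircuit V} (h : (div a b).Valid) :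
    denom (div a b) = denom a * denom b * MvPolynomial.constantCoeff b.poly := by
  rw [denom, clearDenoms, multiplierValue, poly_scale h.1.varFree_clearDenoms.2,
    h.2.1.poly_clearDenoms, map_mul, map_mul, MvPolynomial.constantCoeff_C,
    MvPolynomial.constantCoeff_C, mul_assoc, denom, denom]

theorem Valid.denom_ne_zero {C : AlgCircuit V} (hC : C.Valid) : denom C ≠ 0 := by
  induction C with
  | var | zero | one | negOne => simp [clearDenoms, denom, multiplierValue]
  | add a b iha ihb => rw [denom_add]; exact mul_ne_zero (iha hC.1) (ihb hC.2)
  | mul a b iha ihb => rw [denom_mul]; exact mul_ne_zero (iha hC.1) (ihb hC.2)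
  | div a b iha ihb =>
    rw [hC.denom_div]
    exact mul_ne_zero (mul_ne_zero (iha hC.1) (ihb hC.2.1))
      (hC.2.2.1.constantCoeff_ne_zero hC.2.2.2)

theorem DivFree.two_le_intLength {C : AlgCircuit V} (hC : C.DivFree) : 2 ≤ C.intLength := by
  induction C with
  | var | zero | one | negOne => exact le_rfl
  | add a b iha ihb | mul a b iha ihb =>
    have := iha hC.1
    simp only [intLength]
    omega
  | div => exact hC.elim

theorem DivFree.intLength_le_of_mem_nodes {C E : AlgCircuit V} (hC : C.DivFree)
    (h : E ∈ C.nodes) : E.intLength ≤ C.intLength := by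
  classical
  induction C with
  | var | zero | one | negOne => simp only [nodes, Finset.mem_singleton] at h; rw [h]
  | add a b iha ihb | mul a b iha ihb =>
    simp only [nodes, Finset.mem_insert, Finset.mem_union] at h
    rcases h with rfl | h | h
    · rfl
    · have := iha hC.1 h; simp only [intLength]; omega
    · have := ihb hC.2 h; simp only [intLength]; omega
  | div => exact hC.elim

/-- A division-free circuit without variables computes an integer `z` with
`|z| < 2 ^ (intLength - 1)`. -/
theorem DivFree.exists_int {C : AlgCircuit V} (hC : C.DivFree) (hv : C.VarFree) :
    ∃ z : ℤ, MvPolynomial.constantCoeff C.poly = z ∧ z.natAbs < 2 ^ (C.intLength - 1) := by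
  induction C with
  | var => exact hv.elim
  | zero => exact ⟨0, by simp [poly], by simp⟩
  | one => exact ⟨1, by simp [poly], by simp [intLength]⟩
  | negOne => exact ⟨-1, by simp [poly], by simp [intLength]⟩
  | add a b iha ihb =>
    obtain ⟨x, hx, hx'⟩ := iha hC.1 hv.1
    obtain ⟨y, hy, hy'⟩ := ihb hC.2 hv.2
    have ha := hC.1.two_le_intLength
    refine ⟨x + y, by simp [poly, hx, hy], ?_⟩
    set m := max a.intLength b.intLength with hm
    have h₁ := hx'.trans_le (Nat.pow_le_pow_right two_pos (show a.intLength - 1 ≤ m - 1 by omega))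
    have h₂ := hy'.trans_le (Nat.pow_le_pow_right two_pos (show b.intLength - 1 ≤ m - 1 by omega))
    rw [intLength, ← hm, show m + 1 - 1 = (m - 1) + 1 by omega, pow_succ]
    have := Int.natAbs_add_le x y
    omega
  | mul a b iha ihb =>
    obtain ⟨x, hx, hx'⟩ := iha hC.1 hv.1
    obtain ⟨y, hy, hy'⟩ := ihb hC.2 hv.2
    refine ⟨x * y, by simp [poly, hx, hy], ?_⟩
    rw [Int.natAbs_mul]
    refine (Nat.mul_lt_mul'' hx' hy').trans_le ?_
    rw [← pow_add, intLength]
    exact Nat.pow_le_pow_right two_pos (by omega)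
  | div => exact hC.elim

/-- The circuits that occur when the denominators of `C` are cleared. -/
noncomputable def clearedGates (C : AlgCircuit V) : Finset (AlgCircuit V) := by
  classical exact C.nodes.biUnion fun g =>
    (clearDenoms g).1.nodes ∪ (clearDenoms g).2.elim ∅ nodes

theorem nodes_clearDenoms_subset {C g : AlgCircuit V} (h : g ∈ C.nodes) :
    (clearDenoms g).1.nodes ⊆ C.clearedGates := by
  classical
  exact fun x hx => Finset.mem_biUnion.2 ⟨g, h, Finset.mem_union_left _ hx⟩

theorem nodes_multiplier_subset {C g l : AlgCircuit V} (h : g ∈ C.nodes)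
    (hl : l ∈ (clearDenoms g).2) : l.nodes ⊆ C.clearedGates := by
  classical
  rw [Option.mem_def] at hl
  exact fun x hx => Finset.mem_biUnion.2 ⟨g, h, Finset.mem_union_right _ (by rw [hl]; exact hx)⟩

theorem exists_of_mem_clearedGates {C E : AlgCircuit V} (h : E ∈ C.clearedGates) :
    E.nodes ⊆ C.clearedGates ∧ E.DivFree := by
  classical
  obtain ⟨g, hg, h⟩ := Finset.mem_biUnion.1 h
  rcases Finset.mem_union.1 h with h | h
  · exact ⟨(nodes_subset_of_mem h).trans (nodes_clearDenoms_subset hg),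
      (divFree_clearDenoms g).1.of_mem_nodes h⟩
  · cases hl : (clearDenoms g).2 with
    | none => rw [hl] at h; simp at h
    | some l =>
      rw [hl] at h
      exact ⟨(nodes_subset_of_mem h).trans (nodes_multiplier_subset hg hl),
        ((divFree_clearDenoms g).2 l hl).of_mem_nodes h⟩

open Classical in
/-- The new circuits that are built at a gate when denominators are cleared. -/
noncomputable def newGates (g : AlgCircuit V) : Finset (AlgCircuit V) :=
  insert (clearDenoms g).1 ((clearDenoms g).2.toFinset ∪ match g with
    | add a b =>
      {scale (clearDenoms b).2 (clearDenoms a).1, scale (clearDenoms a).2 (clearDenoms b).1}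
    | _ => ∅)

theorem card_newGates_le (g : AlgCircuit V) : g.newGates.card ≤ 4 := by
  classical
  have h₁ : (clearDenoms g).2.toFinset.card ≤ 1 := by
    cases (clearDenoms g).2 <;> simp
  refine (Finset.card_insert_le _ _).trans (Nat.succ_le_succ
    ((Finset.card_union_le _ _).trans (Nat.add_le_add (d := 2) h₁ ?_)))
  cases g <;> simp [Finset.card_le_two]

theorem nodes_scale_subset {k : Option (AlgCircuit V)} {a : AlgCircuit V}
    {T : Finset (AlgCircuit V)} (h : scale k a ∈ T) (hk : ∀ l ∈ k, l.nodes ⊆ T)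
    (ha : a.nodes ⊆ T) : (scale k a).nodes ⊆ T := by
  classical
  cases k with
  | none => exact ha
  | some l => exact Finset.insert_subset h (Finset.union_subset (hk l rfl) ha)

theorem nodes_mulMultiplier_subset {k l : Option (AlgCircuit V)} {T : Finset (AlgCircuit V)}
    (h : ∀ u ∈ mulMultiplier k l, u ∈ T) (hk : ∀ u ∈ k, u.nodes ⊆ T)
    (hl : ∀ u ∈ l, u.nodes ⊆ T) : ∀ u ∈ mulMultiplier k l, u.nodes ⊆ T := by
  intro u hu
  cases l with
  | none => exact hk u hu
  | some l =>
    have := h u hu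
    cases hu
    exact nodes_scale_subset this hk (hl l rfl)

theorem nodes_clearDenoms_subset_of_newGates {C : AlgCircuit V} {T : Finset (AlgCircuit V)}
    (hT : ∀ g ∈ C.nodes, g.newGates ⊆ T) :
    (clearDenoms C).1.nodes ⊆ T ∧ ∀ l ∈ (clearDenoms C).2, l.nodes ⊆ T := by
  classical
  have key : ∀ g : AlgCircuit V, g.newGates ⊆ T →
      (clearDenoms g).1 ∈ T ∧ ∀ l ∈ (clearDenoms g).2, l ∈ T := fun g hg =>
    ⟨hg (by simp [newGates]), fun l hl => hg (by
      simp only [newGates, Finset.mem_insert, Finset.mem_union, Option.mem_toFinset]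
      exact Or.inr (Or.inl hl))⟩
  induction C with
  | var | zero | one | negOne =>
    exact ⟨by simpa [clearDenoms, nodes] using (key _ (hT _ (self_mem_nodes _))).1, fun l hl => by cases hl⟩
  | add a b iha ihb =>
    have h₀ := hT _ (self_mem_nodes _)
    obtain ⟨h₁, h₂⟩ := key _ h₀
    have ha : ∀ g ∈ a.nodes, g.newGates ⊆ T := fun g hg => hT g (by simp [nodes, hg])
    have hb : ∀ g ∈ b.nodes, g.newGates ⊆ T := fun g hg => hT g (by simp [nodes, hg])
    obtain ⟨ha, ha'⟩ := iha ha
    obtain ⟨hb, hb'⟩ := ihb hb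
    exact ⟨Finset.insert_subset h₁ (Finset.union_subset
        (nodes_scale_subset (h₀ (by simp [newGates])) hb' ha)
        (nodes_scale_subset (h₀ (by simp [newGates])) ha' hb)),
      nodes_mulMultiplier_subset h₂ ha' hb'⟩
  | mul a b iha ihb =>
    have h₀ := hT _ (self_mem_nodes _)
    obtain ⟨h₁, h₂⟩ := key _ h₀
    have ha : ∀ g ∈ a.nodes, g.newGates ⊆ T := fun g hg => hT g (by simp [nodes, hg])
    have hb : ∀ g ∈ b.nodes, g.newGates ⊆ T := fun g hg => hT g (by simp [nodes, hg])
    obtain ⟨ha, ha'⟩ := iha ha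
    obtain ⟨hb, hb'⟩ := ihb hb
    exact ⟨Finset.insert_subset h₁ (Finset.union_subset ha hb),
      nodes_mulMultiplier_subset h₂ ha' hb'⟩
  | div a b iha ihb =>
    have h₀ := hT _ (self_mem_nodes _)
    obtain ⟨h₁, h₂⟩ := key _ h₀
    have ha : ∀ g ∈ a.nodes, g.newGates ⊆ T := fun g hg => hT g (by simp [nodes, hg])
    have hb : ∀ g ∈ b.nodes, g.newGates ⊆ T := fun g hg => hT g (by simp [nodes, hg])
    obtain ⟨ha, ha'⟩ := iha ha
    obtain ⟨hb, hb'⟩ := ihb hb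
    refine ⟨nodes_scale_subset h₁ hb' ha, fun l hl => ?_⟩
    have := h₂ l hl
    cases hl
    exact nodes_scale_subset this ha' hb

/-- Clearing denominators increases the size at most by a constant factor. -/
theorem card_clearedGates_le (C : AlgCircuit V) : C.clearedGates.card ≤ 4 * C.size := by
  classical
  have h : C.clearedGates ⊆ C.nodes.biUnion newGates := by
    refine Finset.biUnion_subset.2 fun g hg => ?_
    have := nodes_clearDenoms_subset_of_newGates (C := g) (T := C.nodes.biUnion newGates)
      fun d hd => Finset.subset_biUnion_of_mem newGates (nodes_subset_of_mem hg hd)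
    refine Finset.union_subset this.1 ?_
    cases hl : (clearDenoms g).2 with
    | none => simp
    | some l => exact this.2 l hl
  refine (Finset.card_le_card h).trans ((Finset.card_biUnion_le_card_mul _ _ 4
    fun g _ => card_newGates_le g).trans (le_of_eq ?_))
  rw [size, mul_comm]

/-- The absolute value of the denominator of a circuit is an integer with small `τ`. -/
theorem Valid.exists_int_denom {C : AlgCircuit V} (hC : C.Valid) :
    ∃ M : ℤ, 0 < M ∧ |denom C| = M ∧ integerTau M ≤ 7 * C.size := by
  classical
  have key : ∀ (M : ℤ) (E : AlgCircuit Empty), E.DivFree → E.poly = MvPolynomial.C (M : ℚ) →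
      integerTau M ≤ E.size := fun M E h₁ h₂ => Nat.sInf_le ⟨E, h₁, h₂, rfl⟩
  have hpos := C.size_pos
  cases hl : (clearDenoms C).2 with
  | none =>
    refine ⟨1, one_pos, by simp [denom, hl, multiplierValue], ?_⟩
    refine (key 1 one trivial (by simp [poly])).trans ?_
    simp only [size, nodes, Finset.card_singleton] at hpos ⊢
    omega
  | some l =>
    have hd := (divFree_clearDenoms C).2 l hl
    have hv := hC.varFree_clearDenoms.2 l hl
    obtain ⟨z, hz, -⟩ := hd.exists_int hv
    have hden : denom C = z := by rw [denom, hl, multiplierValue, hz]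
    have hz0 : z ≠ 0 := fun h => hC.denom_ne_zero (by rw [hden, h, Int.cast_zero])
    set E : AlgCircuit Empty := AlgCircuit.subst (fun _ => zero) l with hE
    have hEd : E.DivFree := hd.subst fun _ => trivial
    have hEp : E.poly = MvPolynomial.C (z : ℚ) := by
      rw [hE, hd.valid.poly_subst, hv.poly_eq, hz, MvPolynomial.bind₁_C_right]
    have hEs : E.size ≤ 4 * C.size + 1 := by
      have h₁ : E.nodes ⊆ l.nodes.image (AlgCircuit.subst fun _ => zero) ∪ {zero} :=
        nodes_subst_subset fun v _ => by simp [nodes]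
      have h₂ := Finset.card_le_card (nodes_multiplier_subset (self_mem_nodes C) hl)
      have h₃ := C.card_clearedGates_le
      have h₄ := (Finset.card_le_card h₁).trans (Finset.card_union_le _ _)
      have h₅ := Finset.card_image_le (s := l.nodes) (f := AlgCircuit.subst fun _ => (zero : AlgCircuit Empty))
      simp only [Finset.card_singleton] at h₄
      rw [size]
      omega
    refine ⟨|z|, abs_pos.2 hz0, by rw [hden, Int.cast_abs], ?_⟩
    rcases abs_choice z with h | h <;> rw [h]
    · exact (key z E hEd hEp).trans (by omega)
    · refine (key (-z) (mul negOne E) ⟨trivial, hEd⟩ (by simp [poly, hEp])).trans ?_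
      have : (mul negOne E).size ≤ E.size + 2 := by
        refine (Finset.card_insert_le _ _).trans (Nat.succ_le_succ
          ((Finset.card_union_le _ _).trans ?_))
        simp [nodes, size, add_comm]
      omega

/-! ### Conic circuits -/

variable {Y : Set V} {a b : AlgCircuit V}

theorem Conic.of_add (h : (add a b).Conic Y) : a.Conic Y ∧ b.Conic Y :=
  ⟨⟨fun p => h.1 (.add_left _ p), fun v hv p => h.2 v hv (.add_left _ p)⟩,
    ⟨fun p => h.1 (.add_right _ p), fun v hv p => h.2 v hv (.add_right _ p)⟩⟩

theorem Conic.of_mul (h : (mul a b).Conic Y) (hab : a ≠ b) : a.Conic Y ∧ b.Conic Y :=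
  ⟨⟨fun p => h.1 (.mul_left hab p), fun v hv p => h.2 v hv (.mul_left hab p)⟩,
    ⟨fun p => h.1 (.mul_right hab p), fun v hv p => h.2 v hv (.mul_right hab p)⟩⟩

theorem Conic.of_div (h : (div a b).Conic Y) : a.Conic Y ∧ b.Conic Y :=
  ⟨⟨fun p => h.1 (.div_left _ p), fun v hv p => h.2 v hv (.div_left _ p)⟩,
    ⟨fun p => h.1 (.div_right _ p), fun v hv p => h.2 v hv (.div_right _ p)⟩⟩

/-- A conic circuit without variables computes a nonnegative number. -/
theorem Conic.constantCoeff_nonneg {C : AlgCircuit V} (hC : C.Conic Y) (hv : C.VarFree) :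
    0 ≤ MvPolynomial.constantCoeff C.poly := by
  induction C with
  | var => exact hv.elim
  | zero | one => simp [poly]
  | negOne => exact (hC.1 .refl).elim
  | add a b iha ihb =>
    rw [poly, map_add]
    exact add_nonneg (iha hC.of_add.1 hv.1) (ihb hC.of_add.2 hv.2)
  | mul a b iha ihb =>
    rw [poly, map_mul]
    by_cases hab : a = b
    · rw [hab]; exact mul_self_nonneg _
    · exact mul_nonneg (iha (hC.of_mul hab).1 hv.1) (ihb (hC.of_mul hab).2 hv.2)
  | div a b iha ihb =>
    rw [poly, map_mul, MvPolynomial.constantCoeff_C]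
    exact mul_nonneg (inv_nonneg.2 (ihb hC.of_div.2 hv.2)) (iha hC.of_div.1 hv.1)

end AlgCircuit

/-! ### Processing a circuit gate by gate -/

namespace Program

variable {V W : Type}

/-- If a property of the gates of a circuit can be established gate by gate, each time adding at most
`c` gates to a program, then it can be established for all gates at the cost of `c` per *node*: what
has been done for a node is reused wherever the node occurs. -/
theorem exists_extends_forall {Q : Program V → AlgCircuit W → Prop} {c : ℕ} (S₀ : Program V)
    (mono : ∀ S S' E, S.gates ⊆ S'.gates → Q S E → Q S' E)
    (T : Finset (AlgCircuit W)) (hT : ∀ E ∈ T, E.nodes ⊆ T)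
    (step : ∀ E ∈ T, ∀ S, S₀.gates ⊆ S.gates →
      (∀ E' ∈ E.nodes, sizeOf E' < sizeOf E → Q S E') → ∃ S', S.Extends c S' ∧ Q S' E) :
    ∃ S', S₀.Extends (c * T.card) S' ∧ ∀ E ∈ T, Q S' E := by
  classical
  induction hk : T.card generalizing T with
  | zero =>
    rw [Finset.card_eq_zero] at hk
    subst hk
    exact ⟨S₀, .refl _ _, by simp⟩
  | succ k ih =>
    obtain ⟨E, hE, hmax⟩ := T.exists_max_image sizeOf (Finset.card_pos.1 (by omega))
    obtain ⟨S₁, e₁, h₁⟩ := ih (T.erase E) (fun G hG G' hG' => by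
        refine Finset.mem_erase.2 ⟨?_, hT G (Finset.mem_of_mem_erase hG) hG'⟩
        rintro rfl
        have hne := (Finset.mem_erase.1 hG).1
        have := sizeOf_lt_of_mem_nodes hG' hne.symm
        have := hmax G (Finset.mem_of_mem_erase hG)
        omega)
      (fun G hG => step G (Finset.mem_of_mem_erase hG))
      (by rw [Finset.card_erase_of_mem hE, hk]; rfl)
    obtain ⟨S₂, e₂, h₂⟩ := step E hE S₁ e₁.1 fun G hG hlt =>
      h₁ G (Finset.mem_erase.2 ⟨by rintro rfl; omega, hT E hE hG⟩)
    refine ⟨S₂, e₁.trans e₂, fun G hG => ?_⟩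
    by_cases h : G = E
    · exact h ▸ h₂
    · exact mono _ _ _ e₂.1 (h₁ G (Finset.mem_erase.2 ⟨h, hG⟩))

end Program

/-! ### Circuits as values of IPS programs -/

open Program

variable {n m : ℕ}

/-- The value of a circuit in the variables of an IPS proof: the pair of the polynomials that arise
when the placeholders are replaced by `0` and by the axioms.  An IPS proof of `p` is a circuit with
value `(0, p)`. -/
noncomputable def ipsEval (f : Fin m → MvPolynomial (Fin n) ℚ) :
    MvPolynomial (IPSVar n m) ℚ →+* MvPolynomial (Fin n) ℚ × MvPolynomial (Fin n) ℚ :=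
  RingHom.prod (MvPolynomial.bind₁ (ipsZero n m)).toRingHom
    (MvPolynomial.bind₁ (ipsAxiom f)).toRingHom

variable {f : Fin m → MvPolynomial (Fin n) ℚ} {S : Program (IPSVar n m)}

theorem ipsEval_apply (p : MvPolynomial (IPSVar n m) ℚ) : ipsEval f p =
    (MvPolynomial.bind₁ (ipsZero n m) p, MvPolynomial.bind₁ (ipsAxiom f) p) := rfl

/-- The circuits of a finite set become a program, with equal components of their values. -/
theorem exists_program_computes (f : Fin m → MvPolynomial (Fin n) ℚ)
    (T : Finset (AlgCircuit (Fin n))) (hT : ∀ E ∈ T, E.nodes ⊆ T ∧ E.DivFree) :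
    ∃ S : Program (IPSVar n m), S.gates.card ≤ T.card + 3 ∧
      ∀ E ∈ T, Computes (ipsEval f) S (E.poly, E.poly) := by
  classical
  set h : Fin n → AlgCircuit (IPSVar n m) := fun i => var (.x i) with hh
  have hd : ∀ E ∈ T, (E.subst h).DivFree := fun E hE => (hT E hE).2.subst fun _ => trivial
  refine ⟨⟨T.image (subst h) ∪ {zero, one, negOne}, fun c hc => ?_, fun c hc => ?_, by simp, by simp,
    by simp⟩, ?_, fun E hE => 
      ⟨E.subst h, Finset.mem_union_left _ (Finset.mem_image_of_mem _ hE), ?_⟩⟩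
  · rcases Finset.mem_union.1 hc with hc | hc
    · obtain ⟨E, hE, rfl⟩ := Finset.mem_image.1 hc
      refine Finset.Subset.trans ?_ Finset.subset_union_left
      refine (nodes_subst_subset (T := T.image (subst h)) fun v hv => ?_).trans
        (Finset.union_subset (Finset.image_subset_image (hT E hE).1) subset_rfl)
      rw [hh, nodes, Finset.singleton_subset_iff]
      exact Finset.mem_image.2 ⟨var v, (hT E hE).1 hv, rfl⟩
    · refine Finset.Subset.trans ?_ Finset.subset_union_right
      simp only [Finset.mem_insert, Finset.mem_singleton] at hc
      rcases hc with rfl | rfl | rfl <;> simp [nodes]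
  · rcases Finset.mem_union.1 hc with hc | hc
    · obtain ⟨E, hE, rfl⟩ := Finset.mem_image.1 hc
      exact (hd E hE).valid
    · simp only [Finset.mem_insert, Finset.mem_singleton] at hc
      rcases hc with rfl | rfl | rfl <;> trivial
  · exact (Finset.card_union_le _ _).trans
      (Nat.add_le_add Finset.card_image_le Finset.card_le_three)
  · rw [(hT E hE).2.valid.poly_subst, ipsEval_apply, MvPolynomial.bind₁_bind₁,
      MvPolynomial.bind₁_bind₁]
    simp [hh, poly, ipsZero, ipsAxiom]

theorem exists_isBit_x (f : Fin m → MvPolynomial (Fin n) ℚ) (S : Program (IPSVar n m)) (i : Fin n) :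
    ∃ S', S.Extends 2 S' ∧
      IsBit (ipsEval f) S' (MvPolynomial.X i, MvPolynomial.X i) := by
  obtain ⟨S₁, e₁, h₁⟩ := exists_computes_var (ipsEval f) S (.x i)
  obtain ⟨S₂, e₂, h₂⟩ := exists_computes_var (ipsEval f) S₁ (.z i)
  refine ⟨S₂, e₁.trans e₂, ?_, _, h₂, ?_, ?_⟩
  · simpa [ipsEval_apply, ipsZero, ipsAxiom] using h₁.mono e₂.1
  · simp [ipsEval_apply, ipsZero]
  · simp [ipsEval_apply, ipsAxiom]

/-- The values of all gates of a division-free circuit, as differences of unsigned integers. -/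
theorem exists_isSigned (f : Fin m → MvPolynomial (Fin n) ℚ) (S : Program (IPSVar n m))
    {D : AlgCircuit (Fin n)} (hD : D.DivFree) :
    ∃ S', S.Extends (400 * (D.intLength + 1) ^ 2 * D.size) S' ∧
      ∀ E ∈ D.nodes, IsSigned (ipsEval f) S' (E.intLength - 1) E.poly := by
  refine exists_extends_forall (Q := fun S E => IsSigned (ipsEval f) S (E.intLength - 1) E.poly) S
    (fun S S' E hS h => h.mono hS) D.nodes (fun E hE => nodes_subset_of_mem hE)
    fun E hE S _ ih => ?_
  have hd := hD.of_mem_nodes hE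
  have hl := hD.intLength_le_of_mem_nodes hE
  cases E with
  | var i =>
    obtain ⟨S', e, h⟩ := exists_isBit_x f S i
    exact ⟨S', e.mono (by nlinarith), _, 0, h.isNum, isNum_zero _, by simp [poly]⟩
  | zero => exact ⟨S, .refl _ _, 0, 0, isNum_zero _, isNum_zero _, by simp [poly]⟩
  | one => exact ⟨S, .refl _ _, 1, 0, isBit_one.isNum, isNum_zero _, by simp [poly]⟩
  | negOne => exact ⟨S, .refl _ _, 0, 1, isNum_zero _, isBit_one.isNum, by simp [poly]⟩
  | add a b =>
    have ha := ih a (left_mem_nodes_add a b) (by simp; omega)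
    have hb := ih b (right_mem_nodes_add a b) (by simp)
    have h₂ := hd.1.two_le_intLength
    simp only [intLength] at hl ⊢
    obtain ⟨w, hw⟩ : ∃ w, max a.intLength b.intLength = w + 1 :=
      ⟨max a.intLength b.intLength - 1, by omega⟩
    obtain ⟨S', e, h⟩ := (ha.mono_width (l := w) (by omega)).exists_add
      (hb.mono_width (l := w) (by omega))
    rw [hw] at hl ⊢
    exact ⟨S', e.mono (by nlinarith), h⟩
  | mul a b =>
    have ha := ih a (left_mem_nodes_mul a b) (by simp; omega)
    have hb := ih b (right_mem_nodes_mul a b) (by simp)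
    have h₂ := hd.1.two_le_intLength
    simp only [intLength] at hl ⊢
    obtain ⟨w, hw⟩ : ∃ w, max a.intLength b.intLength = w + 1 :=
      ⟨max a.intLength b.intLength - 1, by omega⟩
    obtain ⟨S', e, h⟩ := (ha.mono_width (l := w) (by omega)).exists_mul
      (hb.mono_width (l := w) (by omega))
    rw [hw] at hl ⊢
    exact ⟨S', e.mono (by nlinarith), h.mono_width (by omega)⟩
  | div => exact hd.elim

/-! ### Nonnegativity of conic circuits -/

theorem exists_isNonneg_scale {k : Option (AlgCircuit (Fin n))}
    (hk : ∀ l ∈ k, l.DivFree ∧ l.VarFree) {a : AlgCircuit (Fin n)} {t : ℕ}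
    (ht : (scale k a).intLength ≤ t) {v : MvPolynomial (Fin n) ℚ}
    (hv : IsNonneg (ipsEval f) S (a.intLength - 1) v) :
    ∃ S', S.Extends (80 * (t + 1) ^ 2) S' ∧
      IsNonneg (ipsEval f) S' ((scale k a).intLength - 1)
        (MvPolynomial.C |multiplierValue k| * v) := by
  cases k with
  | none => exact ⟨S, .refl _ _, by simpa [multiplierValue, scale] using hv⟩
  | some l =>
    obtain ⟨hd, hvf⟩ := hk l rfl
    obtain ⟨z, hz, hlt⟩ := hd.exists_int hvf
    simp only [scale, intLength] at ht ⊢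
    set w := max l.intLength a.intLength - 1 with hw
    obtain ⟨S₁, e₁, h₁⟩ := exists_isNonneg_natCast (ipsEval f) S (w := w)
      (hlt.trans_le (Nat.pow_le_pow_right two_pos (by omega)))
    obtain ⟨S₂, e₂, h₂⟩ := h₁.exists_mul ((hv.mono_width (l := w) (by omega)).mono e₁.1)
    have hwt : w ≤ t := by omega
    refine ⟨S₂, (e₁.trans e₂).mono (by nlinarith), ?_⟩
    have : (MvPolynomial.C |multiplierValue (some l)| : MvPolynomial (Fin n) ℚ) = (z.natAbs : ℕ) := by
      rw [multiplierValue, hz, ← Int.cast_abs, Int.abs_eq_natAbs, Int.cast_natCast, map_natCast]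
    rw [this]
    exact h₂.mono_width (by omega)

/-- The axioms of a CPS refutation are nonnegative: those from the equations and the boolean axioms
because they vanish, `x_i` and `1 - x_i` because they are bits. -/
theorem exists_isNonneg_cpsAxiom {F : Fin m → AlgCircuit (Fin n)} {v : CPSVar n m}
    (hv : v ∈ cpsPlaceholders n m) {w : ℕ} (hw : 1 ≤ w)
    (hS : ∀ j, v = .eqPos j ∨ v = .eqNeg j → Computes (ipsEval fun j => (F j).poly) S
      (MvPolynomial.C (denom (F j)), MvPolynomial.C (denom (F j)))) :
    ∃ S', S.Extends 10 S' ∧ IsNonneg (ipsEval fun j => (F j).poly) S' w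
      (MvPolynomial.C |denom (cpsAxiom F v)| * (cpsAxiom F v).poly) := by
  set φ := ipsEval fun j => (F j).poly with hφ
  have habs : ∀ j, v = .eqPos j ∨ v = .eqNeg j →
      CostLE φ S 1 (MvPolynomial.C |denom (F j)|, MvPolynomial.C |denom (F j)|) := by
    intro j hj
    rcases abs_choice (denom (F j)) with h | h <;> rw [h]
    · exact fun S₁ h₁ => ⟨S₁, .refl _ _, (hS j hj).mono h₁⟩
    · have := (hS j hj).costLE.neg
      simpa using this
  cases v with
  | x i => exact (hv i rfl).elim
  | eqPos j =>
    obtain ⟨S₁, e₁, h₁⟩ := exists_computes_var φ S (.y j)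
    obtain ⟨S₂, e₂, h₂⟩ := (((habs j (.inl rfl)).mono e₁.1).mul h₁.costLE).exists_computes
    refine ⟨S₂, (e₁.trans e₂).mono (by norm_num), ?_⟩
    have := h₂.isNonneg (by simp [hφ, ipsEval_apply, ipsZero]) w
    simpa [hφ, ipsEval_apply, ipsAxiom, cpsAxiom] using this
  | eqNeg j =>
    obtain ⟨S₁, e₁, h₁⟩ := exists_computes_var φ S (.y j)
    obtain ⟨S₂, e₂, h₂⟩ := (((habs j (.inr rfl)).mono e₁.1).mul h₁.costLE).neg.exists_computes
    refine ⟨S₂, (e₁.trans e₂).mono (by norm_num), ?_⟩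
    have := h₂.isNonneg (by simp [hφ, ipsEval_apply, ipsZero]) w
    have hd : denom (cpsAxiom F (.eqNeg j)) = denom (F j) := by
      rw [cpsAxiom, denom_mul]; simp [denom, clearDenoms, multiplierValue]
    rw [hd]
    simpa [hφ, ipsEval_apply, ipsAxiom, cpsAxiom, poly] using this
  | boolPos i =>
    obtain ⟨S₁, e₁, h₁⟩ := exists_computes_var φ S (.z i)
    refine ⟨S₁, e₁.mono (by norm_num), ?_⟩
    have := h₁.isNonneg (by simp [hφ, ipsEval_apply, ipsZero]) w
    simpa [hφ, ipsEval_apply, ipsAxiom, cpsAxiom, poly, denom, clearDenoms, mulMultiplier,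
      multiplierValue, sq, sub_eq_add_neg] using this
  | boolNeg i =>
    obtain ⟨S₁, e₁, h₁⟩ := exists_computes_var φ S (.z i)
    obtain ⟨S₂, e₂, h₂⟩ := h₁.costLE.neg.exists_computes
    refine ⟨S₂, (e₁.trans e₂).mono (by norm_num), ?_⟩
    have := h₂.isNonneg (by simp [hφ, ipsEval_apply, ipsZero]) w
    simpa [hφ, ipsEval_apply, ipsAxiom, cpsAxiom, poly, denom, clearDenoms, mulMultiplier,
      multiplierValue, sq, sub_eq_add_neg] using this
  | lower i =>
    obtain ⟨S₁, e₁, h₁⟩ := exists_isBit_x (fun j => (F j).poly) S i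
    refine ⟨S₁, e₁.mono (by norm_num), ?_⟩
    simpa [cpsAxiom, poly, denom, clearDenoms, multiplierValue] using h₁.isNonneg.mono_width hw
  | upper i =>
    obtain ⟨S₁, e₁, h₁⟩ := exists_isBit_x (fun j => (F j).poly) S i
    obtain ⟨S₂, e₂, h₂⟩ := h₁.exists_not
    refine ⟨S₂, (e₁.trans e₂).mono (by norm_num), ?_⟩
    simpa [cpsAxiom, poly, denom, clearDenoms, mulMultiplier, multiplierValue, sub_eq_add_neg]
      using h₂.isNonneg.mono_width hw

theorem mem_nodes_scale (k : Option (AlgCircuit (Fin n))) (a : AlgCircuit (Fin n)) :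
    a ∈ (scale k a).nodes := by
  cases k with
  | none => exact self_mem_nodes a
  | some l => exact right_mem_nodes_mul l a

/-- The values of the conic gates of a CPS refutation are provably nonnegative integers, once they
have been multiplied by the absolute values of their denominators.  Gates whose cleared form does not
occur in `D` are skipped, so that `D` bounds the number of bits. -/
theorem exists_isNonneg {F : Fin m → AlgCircuit (Fin n)} {C : AlgCircuit (CPSVar n m)}
    (hF : ∀ j, (F j).Valid) (hC : C.Valid) {D : AlgCircuit (Fin n)} (hD : D.DivFree)
    (S : Program (IPSVar n m))
    (hS : ∀ E ∈ D.nodes, IsSigned (ipsEval fun j => (F j).poly) S (E.intLength - 1) E.poly)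
    (hden : ∀ j, var (.eqPos j) ∈ C.nodes ∨ var (.eqNeg j) ∈ C.nodes →
      Computes (ipsEval fun j => (F j).poly) S
        (MvPolynomial.C (denom (F j)), MvPolynomial.C (denom (F j)))) :
    ∃ S', S.Extends (400 * (D.intLength + 1) ^ 2 * C.size) S' ∧
      ∀ g ∈ C.nodes, g.Conic (cpsPlaceholders n m) →
        (clearDenoms (g.subst (cpsAxiom F))).1 ∈ D.nodes →
        IsNonneg (ipsEval fun j => (F j).poly) S'
          ((clearDenoms (g.subst (cpsAxiom F))).1.intLength - 1)
          (MvPolynomial.C |denom (g.subst (cpsAxiom F))| * (g.subst (cpsAxiom F)).poly) := by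
  set φ := ipsEval fun j => (F j).poly with hφ
  have hax : ∀ v, (cpsAxiom F v).Valid := by
    intro v
    cases v <;> simp [cpsAxiom, Valid, hF]
  refine exists_extends_forall (Q := fun S g => g.Conic (cpsPlaceholders n m) →
      (clearDenoms (g.subst (cpsAxiom F))).1 ∈ D.nodes →
      IsNonneg φ S ((clearDenoms (g.subst (cpsAxiom F))).1.intLength - 1)
        (MvPolynomial.C |denom (g.subst (cpsAxiom F))| * (g.subst (cpsAxiom F)).poly)) S
    (fun S S' g hS h h₁ h₂ => (h h₁ h₂).mono hS) C.nodes (fun g hg => nodes_subset_of_mem hg)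
    fun g hg S₁ hS₁ ih => ?_
  by_cases hcon : g.Conic (cpsPlaceholders n m)
  swap
  · exact ⟨S₁, .refl _ _, fun h => absurd h hcon⟩
  by_cases hmem : (clearDenoms (g.subst (cpsAxiom F))).1 ∈ D.nodes
  swap
  · exact ⟨S₁, .refl _ _, fun _ h => absurd h hmem⟩
  suffices ∃ S', S₁.Extends (400 * (D.intLength + 1) ^ 2) S' ∧
      IsNonneg φ S' ((clearDenoms (g.subst (cpsAxiom F))).1.intLength - 1)
        (MvPolynomial.C |denom (g.subst (cpsAxiom F))| * (g.subst (cpsAxiom F)).poly) by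
    obtain ⟨S', e, h⟩ := this
    exact ⟨S', e, fun _ _ => h⟩
  have hg' := hC.of_mem_nodes hg
  have hk : ∀ c : AlgCircuit (CPSVar n m), c.Valid →
      ∀ l ∈ (clearDenoms (c.subst (cpsAxiom F))).2, l.DivFree ∧ l.VarFree := fun c hc l hl =>
    ⟨(divFree_clearDenoms _).2 l hl, (hc.subst hax).varFree_clearDenoms.2 l hl⟩
  have hl := hD.intLength_le_of_mem_nodes hmem
  have hsub := nodes_subset_of_mem hmem
  cases g with
  | var v =>
    have hv : v ∈ cpsPlaceholders n m := by
      by_contra hv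
      exact hcon.2 v hv .refl
    have h₂ := (divFree_clearDenoms (cpsAxiom F v)).1.two_le_intLength
    obtain ⟨S', e, h⟩ := exists_isNonneg_cpsAxiom (S := S₁) (F := F) hv
      (w := (clearDenoms (cpsAxiom F v)).1.intLength - 1) (by omega) fun j hj =>
        (hden j (by rcases hj with rfl | rfl; exacts [.inl hg, .inr hg])).mono hS₁
    exact ⟨S', e.mono (by nlinarith), h⟩
  | zero =>
    exact ⟨S₁, .refl _ _, by
      simpa [AlgCircuit.subst, poly] using computes_zero.isNonneg (φ := φ) (S := S₁) rfl _⟩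
  | one =>
    exact ⟨S₁, .refl _ _, by
      simpa [AlgCircuit.subst, poly, denom, clearDenoms, multiplierValue, intLength] using
        isBit_one.isNonneg (φ := φ) (S := S₁)⟩
  | negOne => exact (hcon.1 .refl).elim
  | add a b =>
    simp only [AlgCircuit.subst, clearDenoms, intLength] at hl hsub ⊢
    have hsa := hsub (left_mem_nodes_add _ _)
    have hsb := hsub (right_mem_nodes_add _ _)
    have ha := ih a (left_mem_nodes_add a b) (by simp; omega) hcon.of_add.1
      (nodes_subset_of_mem hsa (mem_nodes_scale _ _))
    have hb := ih b (right_mem_nodes_add a b) (by simp) hcon.of_add.2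
      (nodes_subset_of_mem hsb (mem_nodes_scale _ _))
    obtain ⟨S₂, e₂, h₂⟩ := exists_isNonneg_scale (hk b hg'.2) (hD.intLength_le_of_mem_nodes hsa) ha
    obtain ⟨S₃, e₃, h₃⟩ := exists_isNonneg_scale (hk a hg'.1) (hD.intLength_le_of_mem_nodes hsb)
      (hb.mono e₂.1)
    have h2 := ((hD.of_mem_nodes hsa)).two_le_intLength
    set A := scale (clearDenoms (b.subst (cpsAxiom F))).2 (clearDenoms (a.subst (cpsAxiom F))).1
    set B := scale (clearDenoms (a.subst (cpsAxiom F))).2 (clearDenoms (b.subst (cpsAxiom F))).1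
    obtain ⟨w, hw⟩ : ∃ w, max A.intLength B.intLength = w + 1 :=
      ⟨max A.intLength B.intLength - 1, by omega⟩
    obtain ⟨S₄, e₄, h₄⟩ := ((h₂.mono e₃.1).mono_width (l := w) (by omega)).exists_add
      (h₃.mono_width (l := w) (by omega))
    rw [hw] at hl ⊢
    refine ⟨S₄, ((e₂.trans e₃).trans e₄).mono (by nlinarith), ?_⟩
    rw [Nat.add_sub_cancel]
    convert h₄ using 1
    rw [denom_add, abs_mul, map_mul, poly, denom, denom]
    ring
  | mul a b =>
    simp only [AlgCircuit.subst, clearDenoms, intLength] at hl hsub ⊢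
    have hsa := hsub (left_mem_nodes_mul _ _)
    have hsb := hsub (right_mem_nodes_mul _ _)
    have h2 := ((hD.of_mem_nodes hsa)).two_le_intLength
    by_cases hab : a = b
    · subst hab
      have h := (hS _ hsa).mono hS₁
      set A := (clearDenoms (a.subst (cpsAxiom F))).1 with hA
      obtain ⟨w, hw⟩ : ∃ w, A.intLength = w + 1 := ⟨A.intLength - 1, by omega⟩
      rw [hw] at h
      obtain ⟨S₂, e₂, h₂⟩ := h.exists_sq
      rw [max_self, hw] at hl ⊢
      refine ⟨S₂, e₂.mono (by simp only [Nat.add_sub_cancel]; nlinarith), ?_⟩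
      convert h₂.mono_width (l := 2 * (w + 1) + 3 - 1) (by omega) using 1
      rw [denom_mul, hA, (hg'.1.subst hax).poly_clearDenoms, poly, abs_mul_self, map_mul]
      ring
    · have ha := ih a (left_mem_nodes_mul a b) (by simp; omega) (hcon.of_mul hab).1 hsa
      have hb := ih b (right_mem_nodes_mul a b) (by simp) (hcon.of_mul hab).2 hsb
      set A := (clearDenoms (a.subst (cpsAxiom F))).1
      set B := (clearDenoms (b.subst (cpsAxiom F))).1
      obtain ⟨w, hw⟩ : ∃ w, max A.intLength B.intLength = w + 1 :=
        ⟨max A.intLength B.intLength - 1, by omega⟩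
      obtain ⟨S₂, e₂, h₂⟩ := (ha.mono_width (l := w) (by omega)).exists_mul
        (hb.mono_width (l := w) (by omega))
      rw [hw] at hl ⊢
      refine ⟨S₂, e₂.mono (by nlinarith), ?_⟩
      convert h₂.mono_width (l := 2 * (w + 1) + 3 - 1) (by omega) using 1
      rw [denom_mul, abs_mul, map_mul, poly]
      ring
  | div a b =>
    have hdiv : (div (a.subst (cpsAxiom F)) (b.subst (cpsAxiom F))).Valid := hg'.subst hax
    obtain ⟨q, hq⟩ : ∃ q, q = MvPolynomial.constantCoeff b.poly := ⟨_, rfl⟩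
    -- The divisor is conic as well, hence positive, and the denominator has the right sign.
    have hqpos : 0 < q := hq ▸ lt_of_le_of_ne (hcon.of_div.2.constantCoeff_nonneg hg'.2.2.1)
      (hg'.2.2.1.constantCoeff_ne_zero hg'.2.2.2).symm
    have hbq : MvPolynomial.constantCoeff (b.subst (cpsAxiom F)).poly = q := by
      rw [hg'.2.1.poly_subst, hg'.2.2.1.poly_eq, MvPolynomial.bind₁_C_right,
        MvPolynomial.constantCoeff_C, hq]
    simp only [AlgCircuit.subst, clearDenoms] at hl hsub ⊢
    have ha := ih a (left_mem_nodes_div a b) (by simp; omega) hcon.of_div.1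
      (hsub (mem_nodes_scale _ _))
    obtain ⟨S₂, e₂, h₂⟩ := exists_isNonneg_scale (hk b hg'.2.1) hl ha
    refine ⟨S₂, e₂.mono (Nat.mul_le_mul_right _ (by norm_num)), ?_⟩
    convert h₂ using 1
    rw [hdiv.denom_div, hbq, poly, hbq, abs_mul, abs_mul, abs_of_pos hqpos, ← mul_assoc, ← mul_assoc,
      ← map_mul, ← map_mul, denom, denom]
    congr 2
    rw [mul_assoc, mul_inv_cancel₀ hqpos.ne', mul_one, mul_comm]

/-! ### The refutation -/

/-- A refutation of the binary value principle turns into a refutation of the equations `f j = 0` if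
certified bits are substituted for its variables. -/
theorem exists_ipsRefutation_of_isNum {t r : ℕ} {M : ℤ} {B : AlgCircuit (IPSVar t 1)}
    (hB : IsIPSRefutation (binaryValuePrinciple t M) B) (hr : B.size ≤ r)
    {p e : MvPolynomial (Fin n) ℚ × MvPolynomial (Fin n) ℚ}
    (hp : IsNum (ipsEval f) S t p) (he : Computes (ipsEval f) S e) (he₁ : e.1 = 0)
    (he₂ : e.2 = p.2 + MvPolynomial.C (M : ℚ)) :
    ∃ R, IsIPSRefutation f R ∧ R.size ≤ r + S.gates.card := by
  classical
  obtain ⟨hBv, hB₀, hB₁⟩ := hB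
  obtain ⟨b, hb, rfl⟩ := hp.exists_bits
  obtain ⟨d, hd, rfl⟩ := he
  choose hbc z hz hz₁ hz₂ using hb
  choose bc hbc hbe using hbc
  choose zc hzc hze using hz
  let h : IPSVar t 1 → AlgCircuit (IPSVar n m)
    | .x i => bc i
    | .y _ => d
    | .z i => zc i
  have hh : ∀ v, h v ∈ S.gates := by
    intro v
    cases v
    exacts [hbc _, hd, hzc _]
  have hfst : ∀ c : AlgCircuit (IPSVar n m),
    MvPolynomial.bind₁ (ipsZero n m) c.poly = (ipsEval f c.poly).1 := fun _ => rfl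
  have hsnd : ∀ c : AlgCircuit (IPSVar n m),
    MvPolynomial.bind₁ (ipsAxiom f) c.poly = (ipsEval f c.poly).2 := fun _ => rfl
  refine ⟨B.subst h, ⟨hBv.subst fun v => S.valid _ (hh v), ?_, ?_⟩, ?_⟩
  · have := congrArg (MvPolynomial.bind₁ fun i => (b i).1) hB₀
    rw [map_zero, MvPolynomial.bind₁_bind₁] at this
    rw [hBv.poly_subst, MvPolynomial.bind₁_bind₁, ← this]
    congr 2
    funext v
    rw [hfst]
    cases v with
    | x i => simp [h, hbe, ipsZero]
    | y j => simp [h, he₁, ipsZero]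
    | z i => simp [h, hze, hz₁, ipsZero]
  · have := congrArg (MvPolynomial.bind₁ fun i => (b i).2) hB₁
    rw [map_one, MvPolynomial.bind₁_bind₁] at this
    rw [hBv.poly_subst, MvPolynomial.bind₁_bind₁, ← this]
    congr 2
    funext v
    rw [hsnd]
    cases v with
    | x i => simp [h, hbe, ipsAxiom]
    | y j => simp [h, he₂, ipsAxiom, binaryValuePrinciple, Prod.snd_sum, map_ofNat]
    | z i => simp [h, hze, hz₂, ipsAxiom]
  · have h₁ := nodes_subst_subset (C := B) (h := h) (T := S.gates) fun v _ => S.closed _ (hh v)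
    have h₂ := (Finset.card_le_card h₁).trans (Finset.card_union_le _ _)
    have h₃ := Finset.card_image_le (s := B.nodes) (f := subst h)
    simp only [size] at hr ⊢
    omega

theorem theorem5p1 :
    ∃ (c : ℕ) (P : MvPolynomial (Fin 3) ℕ),
      ∀ (n m : ℕ) (F : Fin m → AlgCircuit (Fin n)) (C : AlgCircuit (CPSVar n m)) (s t r : ℕ),
        (∀ j, (F j).Valid) →
        IsCPSRefutation F C →
        -- the size, of `C(x, y)` as well as after the substitution of the axioms, is at most `s`
        C.size ≤ s → (C.subst (cpsAxiom F)).size ≤ s →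
        (C.subst (cpsAxiom F)).syntacticLength = t →
        (∀ M : ℤ, 0 < M → integerTau M ≤ c * s →
          ∃ B, IsIPSRefutation (binaryValuePrinciple t M) B ∧ B.size ≤ r) →
        ∃ R, IsIPSRefutation (fun j => (F j).poly) R ∧ R.size ≤ MvPolynomial.eval ![s, t, r] P := by
  refine ⟨7, 2004 * MvPolynomial.X 0 * (MvPolynomial.X 1 + 1) ^ 2 + MvPolynomial.X 2 + 4, ?_⟩
  intro n m F C s t r hF hC hs hs' ht hB
  obtain ⟨hCv, hcon, hpoly⟩ := hC
  have hax : ∀ v, (cpsAxiom F v).Valid := by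
    intro v
    cases v <;> simp [cpsAxiom, Valid, hF]
  have hDv : (C.subst (cpsAxiom F)).Valid := hCv.subst hax
  set D := C.subst (cpsAxiom F) with hD
  have hcard := D.card_clearedGates_le
  have hsub : (clearDenoms D).1.nodes ⊆ D.clearedGates := nodes_clearDenoms_subset (self_mem_nodes D)
  have hdf := (divFree_clearDenoms D).1
  have hsize : (clearDenoms D).1.size ≤ 4 * s := (Finset.card_le_card hsub).trans (by omega)
  rw [syntacticLength] at ht
  obtain ⟨S₀, h₀, hS₀⟩ := exists_program_computes (fun j => (F j).poly) D.clearedGates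
    fun E hE => exists_of_mem_clearedGates hE
  obtain ⟨S₁, e₁, h₁⟩ := exists_isSigned (fun j => (F j).poly) S₀ hdf
  have hden : ∀ j, var (.eqPos j) ∈ C.nodes ∨ var (.eqNeg j) ∈ C.nodes →
      Computes (ipsEval fun j => (F j).poly) S₁
        (MvPolynomial.C (denom (F j)), MvPolynomial.C (denom (F j))) := by
    intro j hj
    have hmem : F j ∈ D.nodes := by
      rcases hj with hj | hj
      · exact subst_mem_nodes_subst (cpsAxiom F) hj
      · exact nodes_subset_of_mem (subst_mem_nodes_subst (cpsAxiom F) hj)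
          (right_mem_nodes_mul negOne (F j))
    rw [denom]
    cases hl : (clearDenoms (F j)).2 with
    | none => exact ⟨_, S₁.one_mem, by simp [poly, multiplierValue, Prod.ext_iff]⟩
    | some l =>
      have := (hS₀ l (nodes_multiplier_subset hmem hl (self_mem_nodes l))).mono e₁.1
      rwa [((hF j).varFree_clearDenoms.2 l hl).poly_eq] at this
  obtain ⟨S₂, e₂, h₂⟩ := exists_isNonneg hF hCv hdf S₁ h₁ hden
  obtain ⟨p, e, hp, -, he, he₁, hpe⟩ := h₂ C (self_mem_nodes C) hcon (self_mem_nodes _)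
  obtain ⟨M, hM, hM', hτ⟩ := hDv.exists_int_denom
  obtain ⟨B, hB, hr⟩ := hB M hM (hτ.trans (Nat.mul_le_mul_left 7 hs'))
  obtain ⟨S₃, e₃, h₃⟩ := he.costLE.neg.exists_computes
  rw [← hD, hpoly, hM'] at hpe
  obtain ⟨R, hR, hR'⟩ := exists_ipsRefutation_of_isNum hB hr
    ((hp.mono e₃.1).mono_width (l := t) (by rw [← hD]; omega)) h₃ (by simp [he₁])
    (by rw [Prod.snd_neg]; linear_combination hpe)
  refine ⟨R, hR, hR'.trans ?_⟩
  have c₁ := e₁.2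
  have c₂ := e₂.2
  have c₃ := e₃.2
  rw [ht] at c₁ c₂
  have hm₁ := Nat.mul_le_mul_left (400 * (t + 1) ^ 2) hsize
  have hm₂ := Nat.mul_le_mul_left (400 * (t + 1) ^ 2) hs
  have hm₃ : s * 1 ≤ s * (t + 1) ^ 2 := Nat.mul_le_mul_left s (Nat.one_le_pow _ _ (Nat.succ_pos t))
  simp only [map_add, map_mul, map_pow, map_one, MvPolynomial.eval_X, map_ofNat,
    Matrix.cons_val_zero, Matrix.cons_val_one, Matrix.cons_val]
  nlinarith
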